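/- Let $0<q<1$ and $L>0$, and let $(\mathbb{E},\|\cdot\|_{\mathbb{E}})$ be a complex Banach space. For real numbers $a<b\le a+2\pi$ and $\rho>0$ write $S(a,b,\rho)=\{re^{\sqrt{-1}\theta}:0<r<\rho,\ a<\theta<b\}$; its proper subsectors are the sets $S(a_1,b_1,\rho_1)$ with $a<a_1<b_1<b$ and $0<\rho_1<\rho$. Let $\{\mathcal{E}_i\}_{0\le i\le\nu-1}$ be a good covering in $\mathbb{C}^*$, that is, $\mathcal{E}_i=S(a_i,b_i,\epsilon_0)$ are sectors of common finite radius $\epsilon_0$ such that $\mathcal{E}_i\cap\mathcal{E}_{i+1}\ne\emptyset$ for $0\le i\le\nu-1$ (with $\mathcal{E}_\nu=\mathcal{E}_0$), such that $\bigcup_i\mathcal{E}_i$ contains a punctured disc $D(0,r_0)\setminus\{0\}$, $r_0>0$, and which are numbered consecutively around the origin: $a_0\le\dots\le a_{\nu-1}\le a_0+2\pi$ and $b_0\le\dots\le b_{\nu-1}\le b_0+2\pi$, or the same holds after the order of the indices is reversed. For $0\le i\le\nu-1$ let $G_i:\mathcal{E}_i\to\mathbb{E}$ be holomorphic and bounded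 as $\epsilon\in\mathcal{E}_i$ tends to $0$. Suppose that for every $0\le i\le\nu-1$ there is $C_i>0$ such that $\Delta_i=G_{i+1}-G_i$ (with $G_\nu=G_0$) satisfies $$\|\Delta_i(\epsilon)\|_{\mathbb{E}}\le C_i\exp\Big(-\frac1L\,\frac{\log^2|\epsilon|}{2(-\log q)}\Big),\qquad \epsilon\in\mathcal{E}_i\cap\mathcal{E}_{i+1}.$$ Then there is a formal power series $\hat G(\epsilon)=\sum_{n\ge0}g_n\epsilon^n\in\mathbb{E}[[\epsilon]]$ such that for every $0\le i\le\nu-1$: (a) for every $\hat L>L$, $G_i$ admits $\hat G$ as its $q$-Gevrey asymptotic expansion of type $\hat L$ on $\mathcal{E}_i$, that is, for every proper subsector $W$ of $\mathcal{E}_i$ there are $C,H>0$ with $$\Big\|G_i(\epsilon)-\sum_{n=0}^{N}g_n\epsilon^n\Big\|_{\mathbb{E}}\le C H^N q^{-\hat L N^2/2}\,\frac{|\epsilon|^{N+1}}{(N+1)!},\qquad N\ge0,\ \epsilon\in W;$$ (b) for every proper subsector $W$ of $\mathcal{E}_i$ there are $C,H>0$ with $$\Big\|G_i(\epsilon)-\sum_{n=0}^{N}g_n\epsilon^n\Big\|_{\mathbb{E}}\le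 C H^N q^{-L N^2/2}\,|\epsilon|^{N+1},\qquad N\ge0,\ \epsilon\in W.$$ -/

import Mathlib

namespace QGevrey

/-- The open sector with vertex at the origin, directions strictly between `a` and `b` (angles are
read modulo `2π`), and finite radius `ρ`. It does not contain the origin. -/
def sector (a b ρ : ℝ) : Set ℂ :=
  {z | ∃ r θ : ℝ, 0 < r ∧ r < ρ ∧ a < θ ∧ θ < b ∧ z = (r : ℂ) * Complex.exp ((θ : ℂ) * Complex.I)}

/-- The arcs `(a i, b i)` are met in the order of their indices when one turns once around the
origin counterclockwise. -/
def InCyclicOrder {ν : ℕ} (a b : Fin ν → ℝ) : Prop :=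
  Monotone a ∧ Monotone b ∧
    (∀ i j, a i ≤ a j + 2 * Real.pi) ∧ (∀ i j, b i ≤ b j + 2 * Real.pi)

/-- The sectors `sector (a i) (b i) ε₀`, with `i : Fin ν` and indices read cyclically, form a good
covering of `ℂ \ {0}`. The last condition says that the sectors are numbered consecutively around
the origin, counterclockwise or clockwise. -/
def IsGoodCovering {ν : ℕ} [NeZero ν] (a b : Fin ν → ℝ) (ε₀ : ℝ) : Prop :=
  (∀ i, a i < b i ∧ b i ≤ a i + 2 * Real.pi) ∧
    (∀ i, (sector (a i) (b i) ε₀ ∩ sector (a (i + 1)) (b (i + 1)) ε₀).Nonempty) ∧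
    (∃ r₀ : ℝ, 0 < r₀ ∧ Metric.ball (0 : ℂ) r₀ \ {0} ⊆ ⋃ i, sector (a i) (b i) ε₀) ∧
    (InCyclicOrder a b ∨ InCyclicOrder (a ∘ Fin.rev) (b ∘ Fin.rev))

variable {E : Type*} [NormedAddCommGroup E] [NormedSpace ℂ E]

/-- `Δ` has a `q`-exponential decrease of type `L` on `S`. -/
def HasQExpDecrease (q L : ℝ) (S : Set ℂ) (Δ : ℂ → E) : Prop :=
  ∃ C : ℝ, 0 < C ∧ ∀ ε ∈ S,
    ‖Δ ε‖ ≤ C * Real.exp (-(1 / L) * (1 / (2 * (-Real.log q))) * Real.log ‖ε‖ ^ 2)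

/-- On every proper subsector of `sector a b ρ`, for some constants `C, H > 0`, the error of the
partial sums of the formal series `∑ g n ε ^ n` is at most
`C * H ^ N * q ^ (-A N² / 2) * w N * |ε| ^ (N + 1)` for all `N`. -/
def HasWeightedExpansion (q A : ℝ) (w : ℕ → ℝ) (a b ρ : ℝ) (f : ℂ → E) (g : ℕ → E) : Prop :=
  ∀ a₁ b₁ ρ₁ : ℝ, a < a₁ → a₁ < b₁ → b₁ < b → 0 < ρ₁ → ρ₁ < ρ →
    ∃ C H : ℝ, 0 < C ∧ 0 < H ∧ ∀ N : ℕ, ∀ ε ∈ sector a₁ b₁ ρ₁,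
      ‖f ε - ∑ n ∈ Finset.range (N + 1), ε ^ n • g n‖ ≤
        C * H ^ N * q ^ (-(A * (N : ℝ) ^ 2 / 2)) * w N * ‖ε‖ ^ (N + 1)

/-- `f` admits the formal series `∑ g n ε ^ n` as its `q`-Gevrey asymptotic expansion of type `A`
in `sector a b ρ`. -/
def HasQGevreyExpansion (q A a b ρ : ℝ) (f : ℂ → E) (g : ℕ → E) : Prop :=
  HasWeightedExpansion q A (fun N => 1 / ((N + 1).factorial : ℝ)) a b ρ f g

end QGevrey

section

open Set Filter Topology MeasureTheory

namespace QGevrey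

variable {E : Type*} [NormedAddCommGroup E] [NormedSpace ℂ E]

/-! The proof is a Cauchy–Heine argument. Put `Λ = L * -Real.log q` and unroll the covering along
`ℕ`, with angles growing by `2π` per turn. One ray in each consecutive overlap cuts a disc into
sectors, one for each function. Cauchy's theorem on these sectors, summed, expresses the first
function at `ε` through the kernel `1/(ζ - ε)`, integrated against the functions on the outer arcs
and against their differences on the rays (`chainInt_inv_sub`).

Expanding the kernel in powers of `ε/ζ` gives the coefficients and an exact remainder
(`sub_sum_eq_chainInt`). The ray integrals converge because the differences are flat: completing a
square gives `t⁻ᵐ exp(-log² t / (2Λ)) ≤ exp(Λm²/2)`, which is the source of `q^(-LN²/2)`. On a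
proper subsector `|ζ - ε| ≥ c|ζ|` for `ζ` on the rays, so the remainder keeps its full power of `ε`
(`exists_expansion`).

The coefficients so obtained depend on the rays. Uniqueness of asymptotic expansions makes them
independent of the subsector, and flatness of the differences makes them agree for neighbours
(`exists_common_expansion`). This is (b). Part (a) follows since a larger type absorbs `(N+1)!`; the
clockwise case follows by reversing the indices. -/

/-! ### Contour integrals and Cauchy's theorem on sectors -/

/-- The complex number with modulus `t` and argument `θ`, for `0 ≤ t`. -/
noncomputable def polar (t θ : ℝ) : ℂ := (t : ℂ) * Complex.exp ((θ : ℂ) * Complex.I)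

lemma norm_polar {t : ℝ} (ht : 0 ≤ t) (θ : ℝ) : ‖polar t θ‖ = t := by
  simp [polar, Complex.norm_exp_ofReal_mul_I, abs_of_nonneg ht]

lemma polar_ne_zero {t : ℝ} (ht : 0 < t) (θ : ℝ) : polar t θ ≠ 0 := by
  rw [← norm_pos_iff, norm_polar ht.le]; exact ht

lemma continuous_polar : Continuous fun p : ℝ × ℝ => polar p.1 p.2 := by
  unfold polar; fun_prop

lemma continuous_polar_left (θ : ℝ) : Continuous fun t => polar t θ := by
  unfold polar; fun_prop

lemma continuous_polar_right (t : ℝ) : Continuous fun θ => polar t θ := by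
  unfold polar; fun_prop

lemma polar_add_two_pi (t θ : ℝ) : polar t (θ + 2 * Real.pi) = polar t θ := by
  unfold polar
  push_cast
  rw [add_mul, Complex.exp_periodic]

lemma exp_log_add {t : ℝ} (ht : 0 < t) (θ : ℝ) :
    Complex.exp ((Real.log t : ℂ) + θ * Complex.I) = polar t θ := by
  rw [Complex.exp_add, ← Complex.ofReal_exp, Real.exp_log ht, polar]

/-- The contour integral of `H` along the segment of direction `θ` with moduli from `δ` to `ρ`. -/
noncomputable def rayInt (H : ℂ → E) (θ δ ρ : ℝ) : E :=
  ∫ t in δ..ρ, Complex.exp ((θ : ℂ) * Complex.I) • H (polar t θ)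

/-- The contour integral of `H` along the arc of radius `ρ` with arguments from `α` to `β`. -/
noncomputable def arcInt (H : ℂ → E) (ρ α β : ℝ) : E :=
  ∫ θ in α..β, (Complex.I * polar ρ θ) • H (polar ρ θ)

lemma integral_exp_eq_rayInt {H : ℂ → E} {θ δ ρ : ℝ} (hδ : 0 < δ) (hδρ : δ ≤ ρ)
    (hc : ∀ t, δ ≤ t → t ≤ ρ → ContinuousAt H (polar t θ)) :
    ∫ x in Real.log δ..Real.log ρ, Complex.exp (x + θ * Complex.I) •
      H (Complex.exp (x + θ * Complex.I)) = rayInt H θ δ ρ := by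
  have hρ : 0 < ρ := hδ.trans_le hδρ
  have himg : Real.exp '' uIcc (Real.log δ) (Real.log ρ) ⊆ Icc δ ρ := by
    rintro _ ⟨x, hx, rfl⟩
    rw [uIcc_of_le (Real.log_le_log hδ hδρ)] at hx
    exact ⟨(Real.log_le_iff_le_exp hδ).1 hx.1, (Real.le_log_iff_exp_le hρ).1 hx.2⟩
  have h := intervalIntegral.integral_deriv_smul_comp' (a := Real.log δ) (b := Real.log ρ)
    (f := Real.exp) (f' := Real.exp)
    (g := fun t : ℝ => Complex.exp ((θ : ℂ) * Complex.I) • H (polar t θ))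
    (fun x _ => Real.hasDerivAt_exp x) Real.continuous_exp.continuousOn
    (by
      intro t ht
      have ht' := himg ht
      have h1 : ContinuousAt (fun t => H (polar t θ)) t :=
        ContinuousAt.comp' (hc t ht'.1 ht'.2) (continuous_polar_left θ).continuousAt
      exact (h1.const_smul _).continuousWithinAt)
  rw [Real.exp_log hδ, Real.exp_log hρ] at h
  rw [rayInt, ← h]
  refine intervalIntegral.integral_congr fun x _ => ?_
  simp only [Function.comp, polar, Complex.exp_add, Complex.ofReal_exp]
  rw [mul_smul, ← Complex.ofReal_exp, Complex.coe_smul]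

/-- Cauchy's theorem on a closed annular sector. -/
lemma rayInt_add_arcInt_sub_eq_zero {H : ℂ → E} {α β δ ρ : ℝ} (hδ : 0 < δ) (hδρ : δ ≤ ρ)
    (hαβ : α ≤ β) (hd : ∀ t θ, δ ≤ t → t ≤ ρ → α ≤ θ → θ ≤ β → DifferentiableAt ℂ H (polar t θ)) :
    rayInt H α δ ρ - rayInt H β δ ρ + arcInt H ρ α β - arcInt H δ α β = 0 := by
  have hρ : 0 < ρ := hδ.trans_le hδρ
  have hll := Real.log_le_log hδ hδρ
  -- The substitution `ζ = exp w` turns the annular sector into a rectangle; the factor `exp w`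
  -- comes from `dζ`.
  have key := Complex.integral_boundary_rect_eq_zero_of_differentiableOn
    (fun w => Complex.exp w • H (Complex.exp w)) (⟨Real.log δ, α⟩ : ℂ) ⟨Real.log ρ, β⟩ (by
      intro w hw
      rw [uIcc_of_le hll, uIcc_of_le hαβ, Complex.mem_reProdIm] at hw
      obtain ⟨⟨h1, h2⟩, h3, h4⟩ := hw
      have hwp : Complex.exp w = polar (Real.exp w.re) w.im := by
        conv_lhs => rw [← Complex.re_add_im w]
        rw [Complex.exp_add, polar, Complex.ofReal_exp]
      have hH := hd (Real.exp w.re) w.im ((Real.log_le_iff_le_exp hδ).1 h1)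
        ((Real.le_log_iff_exp_le hρ).1 h2) h3 h4
      rw [← hwp] at hH
      exact (Complex.differentiableAt_exp.smul
        (hH.comp w Complex.differentiableAt_exp)).differentiableWithinAt)
  dsimp only at key
  rw [integral_exp_eq_rayInt hδ hδρ fun t h1 h2 => (hd t α h1 h2 le_rfl hαβ).continuousAt,
    integral_exp_eq_rayInt hδ hδρ fun t h1 h2 => (hd t β h1 h2 hαβ le_rfl).continuousAt] at key
  simp only [exp_log_add hδ, exp_log_add hρ] at key
  simp only [arcInt, mul_smul, intervalIntegral.integral_smul]
  exact key

lemma continuousOn_comp_polar {H : ℂ → E} {θ ρ : ℝ}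
    (hc : ∀ t, 0 < t → t ≤ ρ → ContinuousAt H (polar t θ)) :
    ContinuousOn (fun t => Complex.exp ((θ : ℂ) * Complex.I) • H (polar t θ)) (Ioc 0 ρ) := by
  intro t ht
  have h1 : ContinuousAt (fun t => H (polar t θ)) t :=
    ContinuousAt.comp' (hc t ht.1 ht.2) (continuous_polar_left θ).continuousAt
  exact (h1.const_smul _).continuousWithinAt

lemma intervalIntegrable_ray {H : ℂ → E} {θ ρ M : ℝ} (hρ : 0 ≤ ρ)
    (hc : ContinuousOn (fun t => Complex.exp ((θ : ℂ) * Complex.I) • H (polar t θ)) (Ioc 0 ρ))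
    (hM : ∀ t, 0 < t → t ≤ ρ → ‖H (polar t θ)‖ ≤ M) :
    IntervalIntegrable (fun t => Complex.exp ((θ : ℂ) * Complex.I) • H (polar t θ))
      volume 0 ρ := by
  rw [intervalIntegrable_iff_integrableOn_Ioc_of_le hρ]
  refine ⟨hc.aestronglyMeasurable measurableSet_Ioc, ?_⟩
  refine HasFiniteIntegral.restrict_of_bounded (C := M) measure_Ioc_lt_top ?_
  refine (ae_restrict_iff' measurableSet_Ioc).2 (ae_of_all _ fun t ht => ?_)
  rw [norm_smul, Complex.norm_exp_ofReal_mul_I, one_mul]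
  exact hM t ht.1 ht.2

/-- Cauchy's theorem on a closed sector, for functions that are bounded near the vertex. -/
lemma rayInt_sub_add_arcInt_eq_zero {H : ℂ → E} {α β ρ M : ℝ} (hρ : 0 < ρ) (hαβ : α ≤ β)
    (hd : ∀ t θ, 0 < t → t ≤ ρ → α ≤ θ → θ ≤ β → DifferentiableAt ℂ H (polar t θ))
    (hM : ∀ t θ, 0 < t → t ≤ ρ → α ≤ θ → θ ≤ β → ‖H (polar t θ)‖ ≤ M) :
    rayInt H α 0 ρ - rayInt H β 0 ρ + arcInt H ρ α β = 0 := by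
  have hray : ∀ θ, α ≤ θ → θ ≤ β →
      Tendsto (fun δ => rayInt H θ δ ρ) (𝓝[>] 0) (𝓝 (rayInt H θ 0 ρ)) := by
    intro θ h1 h2
    have hi := intervalIntegrable_ray hρ.le
      (continuousOn_comp_polar fun t ht ht' => (hd t θ ht ht' h1 h2).continuousAt)
      (fun t ht ht' => hM t θ ht ht' h1 h2)
    have hcont := intervalIntegral.continuousOn_primitive_interval_left
      ((intervalIntegrable_iff' (by simp)).1 hi)
    have h0 := (hcont 0 left_mem_uIcc).tendsto
    rw [uIcc_of_le hρ.le] at h0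
    exact h0.mono_left (nhdsWithin_le_iff.2 (Icc_mem_nhdsGT hρ))
  -- The inner arc has length `O(δ)` and `H` is bounded on it.
  have harc : Tendsto (fun δ => arcInt H δ α β) (𝓝[>] 0) (𝓝 0) := by
    refine squeeze_zero_norm' (a := fun δ => δ * M * |β - α|) ?_ ?_
    · filter_upwards [Ioc_mem_nhdsGT hρ] with δ hδ
      refine intervalIntegral.norm_integral_le_of_norm_le_const fun θ hθ => ?_
      rw [uIoc_of_le hαβ] at hθ
      rw [norm_smul, norm_mul, Complex.norm_I, one_mul, norm_polar hδ.1.le]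
      exact mul_le_mul_of_nonneg_left (hM δ θ hδ.1 hδ.2 hθ.1.le hθ.2) hδ.1.le
    · have : Tendsto (fun δ : ℝ => δ * M * |β - α|) (𝓝 0) (𝓝 (0 * M * |β - α|)) :=
        (Continuous.tendsto (by fun_prop) 0)
      simpa using this.mono_left nhdsWithin_le_nhds
  have hlim := (((hray α le_rfl hαβ).sub (hray β hαβ le_rfl)).add_const (arcInt H ρ α β)).sub harc
  rw [sub_zero] at hlim
  refine tendsto_nhds_unique hlim (tendsto_const_nhds.congr' ?_)
  filter_upwards [Ioc_mem_nhdsGT hρ] with δ hδ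
  exact (rayInt_add_arcInt_sub_eq_zero hδ.1 hδ.2 hαβ fun t θ h1 h2 h3 h4 =>
    hd t θ (hδ.1.trans_le h1) h2 h3 h4).symm

lemma norm_polar_sub_polar_sq (t s θ φ : ℝ) :
    ‖polar t θ - polar s φ‖ ^ 2 = t ^ 2 + s ^ 2 - 2 * t * s * Real.cos (θ - φ) := by
  rw [Complex.sq_norm, Complex.normSq_apply, Real.cos_sub]
  simp only [polar, Complex.sub_re, Complex.sub_im, Complex.re_ofReal_mul, Complex.im_ofReal_mul,
    Complex.exp_ofReal_mul_I_re, Complex.exp_ofReal_mul_I_im]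
  linear_combination t ^ 2 * Real.sin_sq_add_cos_sq θ + s ^ 2 * Real.sin_sq_add_cos_sq φ

/-- Points whose arguments stay apart are at a distance comparable to their moduli. -/
lemma exists_mul_le_norm_polar_sub_polar {ψ₀ ψ₁ : ℝ} (h₀ : 0 < ψ₀) (h₁ : ψ₁ < 2 * Real.pi) :
    ∃ c : ℝ, 0 < c ∧ ∀ t s θ φ : ℝ, 0 ≤ t → 0 ≤ s → ψ₀ ≤ θ - φ → θ - φ ≤ ψ₁ →
      c * t ≤ ‖polar t θ - polar s φ‖ ∧ c * s ≤ ‖polar t θ - polar s φ‖ := by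
  rcases lt_or_ge ψ₁ ψ₀ with h | h
  · exact ⟨1, one_pos, fun t s θ φ _ _ h1 h2 => absurd (h1.trans h2) (not_le.2 h)⟩
  obtain ⟨x, hx, hmax⟩ := isCompact_Icc.exists_isMaxOn (nonempty_Icc.2 h)
    (Real.continuous_cos.continuousOn)
  have hx1 : Real.cos x < 1 := by
    refine lt_of_le_of_ne (Real.cos_le_one x) fun h1 => ?_
    have := (Real.cos_eq_one_iff_of_lt_of_lt (by linarith [hx.1, Real.pi_pos])
      (by linarith [hx.2])).1 h1
    linarith [hx.1]
  -- Clipping at `0` ensures `κ ^ 2 < 1` even when the cosine is close to `-1`. Then `t² + s² - 2tsκ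
  -- = (s - tκ)² + (1 - κ²)t²`, and likewise with `t` and `s` exchanged.
  set κ := max 0 (Real.cos x) with hκ
  have hκ0 : 0 ≤ κ := le_max_left _ _
  have hκ1 : κ < 1 := max_lt one_pos hx1
  have hpos : 0 < 1 - κ ^ 2 := by nlinarith
  refine ⟨Real.sqrt (1 - κ ^ 2), Real.sqrt_pos.2 hpos, fun t s θ φ ht hs h1 h2 => ?_⟩
  have hcos : Real.cos (θ - φ) ≤ κ := (hmax ⟨h1, h2⟩).trans (le_max_right _ _)
  have hsq := norm_polar_sub_polar_sq t s θ φ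
  have hts : 0 ≤ t * s := mul_nonneg ht hs
  have hm : t * s * Real.cos (θ - φ) ≤ t * s * κ := mul_le_mul_of_nonneg_left hcos hts
  constructor
  · refine abs_le_of_sq_le_sq' ?_ (norm_nonneg _) |>.2
    rw [mul_pow, Real.sq_sqrt hpos.le, hsq]
    nlinarith [sq_nonneg (s - t * κ)]
  · refine abs_le_of_sq_le_sq' ?_ (norm_nonneg _) |>.2
    rw [mul_pow, Real.sq_sqrt hpos.le, hsq]
    nlinarith [sq_nonneg (t - s * κ)]

/-! ### Chains of sectors and Cauchy's integral formula -/

/-- Rays of arguments `r 0 ≤ r 1 ≤ ... ≤ r n = r 0 + 2π` cut the disc of radius `ρ` into sectors;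
`F k` is analytic and bounded on the closed sector between the rays `k` and `k + 1`. -/
structure IsSectorChain (n : ℕ) (r : ℕ → ℝ) (ρ M : ℝ) (F : ℕ → ℂ → E) : Prop where
  pos : 0 < n
  radius_pos : 0 < ρ
  le_succ : ∀ k < n, r k ≤ r (k + 1)
  turn : r n = r 0 + 2 * Real.pi
  periodic : F n = F 0
  analyticAt : ∀ k < n, ∀ t θ, 0 < t → t ≤ ρ → r k ≤ θ → θ ≤ r (k + 1) →
    AnalyticAt ℂ (F k) (polar t θ)
  norm_le : ∀ k < n, ∀ t θ, 0 < t → t ≤ ρ → r k ≤ θ → θ ≤ r (k + 1) → ‖F k (polar t θ)‖ ≤ M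

/-- The functional that sends `h` to the sum of the contour integrals of `h F k` along the outer
arcs and of `h (F (k + 1) - F k)` along the rays. -/
noncomputable def chainInt (n : ℕ) (r : ℕ → ℝ) (ρ : ℝ) (F : ℕ → ℂ → E) (h : ℂ → ℂ) : E :=
  ∑ k ∈ Finset.range n, (arcInt (fun ζ => h ζ • F k ζ) ρ (r k) (r (k + 1)) +
    rayInt (fun ζ => h ζ • (F (k + 1) ζ - F k ζ)) (r (k + 1)) 0 ρ)

lemma rayInt_congr {H K : ℂ → E} {θ ρ : ℝ} (hρ : 0 ≤ ρ)
    (h : ∀ t, 0 < t → t ≤ ρ → H (polar t θ) = K (polar t θ)) :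
    rayInt H θ 0 ρ = rayInt K θ 0 ρ := by
  refine intervalIntegral.integral_congr_ae (ae_of_all _ fun t ht => ?_)
  rw [uIoc_of_le hρ] at ht
  rw [h t ht.1 ht.2]

lemma arcInt_congr {H K : ℂ → E} {α β ρ : ℝ} (hαβ : α ≤ β)
    (h : ∀ θ, α ≤ θ → θ ≤ β → H (polar ρ θ) = K (polar ρ θ)) :
    arcInt H ρ α β = arcInt K ρ α β := by
  refine intervalIntegral.integral_congr fun θ hθ => ?_
  rw [uIcc_of_le hαβ] at hθ
  simp only [h θ hθ.1 hθ.2]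

lemma intervalIntegrable_arc {H : ℂ → E} {α β ρ : ℝ} (hαβ : α ≤ β)
    (h : ∀ θ, α ≤ θ → θ ≤ β → ContinuousAt H (polar ρ θ)) :
    IntervalIntegrable (fun θ => (Complex.I * polar ρ θ) • H (polar ρ θ)) volume α β := by
  refine ContinuousOn.intervalIntegrable fun θ hθ => ?_
  rw [uIcc_of_le hαβ] at hθ
  have h1 : ContinuousAt (fun θ => H (polar ρ θ)) θ :=
    ContinuousAt.comp' (h θ hθ.1 hθ.2) (continuous_polar_right ρ).continuousAt
  have h2 : ContinuousAt (fun θ => Complex.I * polar ρ θ) θ :=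
    (continuous_const.mul (continuous_polar_right ρ)).continuousAt
  exact (h2.smul h1).continuousWithinAt

lemma integral_arc_inv_sub {ε : ℂ} {ρ : ℝ} (hε : ‖ε‖ < ρ) (x : ℝ) :
    ∫ θ in x..x + 2 * Real.pi, (Complex.I * polar ρ θ) * (polar ρ θ - ε)⁻¹ =
      2 * Real.pi * Complex.I := by
  have hp : Function.Periodic
      (fun θ => (Complex.I * polar ρ θ) * (polar ρ θ - ε)⁻¹) (2 * Real.pi) := fun θ => by
    simp only [polar_add_two_pi]
  rw [hp.intervalIntegral_add_eq x 0, zero_add,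
    ← circleIntegral.integral_sub_inv_of_mem_ball (c := 0) (w := ε) (R := ρ) (by simpa using hε)]
  unfold circleIntegral
  refine intervalIntegral.integral_congr fun θ _ => ?_
  simp only [deriv_circleMap, circleMap_zero, polar, smul_eq_mul]
  ring

namespace IsSectorChain

variable {n : ℕ} {r : ℕ → ℝ} {ρ M : ℝ} {F : ℕ → ℂ → E}

lemma ray_mem (hF : IsSectorChain n r ρ M F) {k : ℕ} (hk : k < n) :
    r 1 ≤ r (k + 1) ∧ r (k + 1) ≤ r 0 + 2 * Real.pi := by
  constructor
  · induction k with
    | zero => exact le_rfl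
    | succ k ih => exact (ih (by omega)).trans (hF.le_succ _ hk)
  · rw [← hF.turn]
    obtain ⟨m, rfl⟩ : ∃ m, n = k + 1 + m := ⟨n - (k + 1), by omega⟩
    have : ∀ j ≤ m, r (k + 1) ≤ r (k + 1 + j) := by
      intro j
      induction j with
      | zero => intro _; exact le_rfl
      | succ j ih => intro hj; exact (ih (by omega)).trans (hF.le_succ _ (by omega))
    exact this m le_rfl

/-- For the last ray the chain closes up: `F n = F 0`, and the ray is the initial one after a full
turn. -/
lemma analyticAt_next (hF : IsSectorChain n r ρ M F) {k : ℕ} (hk : k < n) {t : ℝ} (ht : 0 < t)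
    (ht' : t ≤ ρ) : AnalyticAt ℂ (F (k + 1)) (polar t (r (k + 1))) := by
  rcases Nat.lt_or_ge (k + 1) n with h | h
  · exact hF.analyticAt _ h t _ ht ht' le_rfl (hF.le_succ _ h)
  · obtain rfl : n = k + 1 := by omega
    rw [hF.periodic, hF.turn, polar_add_two_pi]
    exact hF.analyticAt _ hF.pos t _ ht ht' le_rfl (hF.le_succ _ hF.pos)

lemma norm_next_le (hF : IsSectorChain n r ρ M F) {k : ℕ} (hk : k < n) {t : ℝ} (ht : 0 < t)
    (ht' : t ≤ ρ) : ‖F (k + 1) (polar t (r (k + 1)))‖ ≤ M := by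
  rcases Nat.lt_or_ge (k + 1) n with h | h
  · exact hF.norm_le _ h t _ ht ht' le_rfl (hF.le_succ _ h)
  · obtain rfl : n = k + 1 := by omega
    rw [hF.periodic, hF.turn, polar_add_two_pi]
    exact hF.norm_le _ hF.pos t _ ht ht' le_rfl (hF.le_succ _ hF.pos)

lemma bound_nonneg (hF : IsSectorChain n r ρ M F) : 0 ≤ M :=
  (norm_nonneg _).trans
    (hF.norm_le 0 hF.pos ρ (r 0) hF.radius_pos le_rfl le_rfl (hF.le_succ 0 hF.pos))

section Point

variable {s φ : ℝ}

/-- The points of the sectors other than the first one stay away from a point of the interior of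
the first one. -/
lemma exists_le_norm_sub (h0 : r 0 < φ) (h1 : φ < r 1) (hs : 0 < s) :
    ∃ c : ℝ, 0 < c ∧ ∀ t θ : ℝ, 0 ≤ t → r 1 ≤ θ → θ ≤ r 0 + 2 * Real.pi →
      c ≤ ‖polar t θ - polar s φ‖ := by
  obtain ⟨c, hc, h⟩ := exists_mul_le_norm_polar_sub_polar (ψ₀ := r 1 - φ)
    (ψ₁ := r 0 + 2 * Real.pi - φ) (by linarith) (by linarith)
  exact ⟨c * s, mul_pos hc hs, fun t θ ht h2 h3 =>
    (h t s θ φ ht hs.le (by linarith) (by linarith)).2⟩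

lemma norm_inv_smul_le {c B : ℝ} {z : ℂ} {v : E} (hc : 0 < c) (hz : c ≤ ‖z‖) (hv : ‖v‖ ≤ B) :
    ‖z⁻¹ • v‖ ≤ c⁻¹ * B := by
  rw [norm_smul, norm_inv]
  exact mul_le_mul (inv_anti₀ hc hz) hv (norm_nonneg _) (by positivity)

/-- The singularity at `polar s φ` is removable: off that point `K` is the `dslope` of `F 0`, which
is differentiable and bounded on the closed sector. The contour avoids the point, so both have the
same integrals. -/
lemma sector_zero [CompleteSpace E] (hF : IsSectorChain n r ρ M F) (h0 : r 0 < φ) (h1 : φ < r 1)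
    (hs : 0 < s) (hsρ : s < ρ) {K : ℂ → E}
    (hK : K = fun ζ => (ζ - polar s φ)⁻¹ • (F 0 ζ - F 0 (polar s φ))) :
    rayInt K (r 0) 0 ρ - rayInt K (r 1) 0 ρ + arcInt K ρ (r 0) (r 1) = 0 := by
  set ε := polar s φ with hε
  obtain ⟨c, hc, hcle⟩ := exists_le_norm_sub h0 h1 hs
  have hDK : ∀ ζ, ζ ≠ ε → dslope (F 0) ε ζ = K ζ := fun ζ hζ => by
    rw [dslope_of_ne _ hζ, hK, slope_def_module]
  -- The lower bound applies to the initial ray only under its name `r 0 + 2π`.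
  have hr0 : ∀ t, 0 < t → polar t (r 0) ≠ ε := fun t ht h => by
    have := hcle t (r 0 + 2 * Real.pi) ht.le
      (by have := (hF.ray_mem hF.pos).2; linarith) le_rfl
    rw [polar_add_two_pi, h, hε, sub_self, norm_zero] at this
    linarith
  have hr1 : ∀ t, 0 < t → polar t (r 1) ≠ ε := fun t ht h => by
    have := hcle t (r 1) ht.le le_rfl (hF.ray_mem hF.pos).2
    rw [h, hε, sub_self, norm_zero] at this
    linarith
  have harc : ∀ θ, polar ρ θ ≠ ε := fun θ h => by
    have := congrArg norm h
    rw [norm_polar hF.radius_pos.le, hε, norm_polar hs.le] at this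
    linarith
  have han : AnalyticAt ℂ (F 0) ε := hF.analyticAt 0 hF.pos s φ hs hsρ.le h0.le h1.le
  have hdε : DifferentiableAt ℂ (dslope (F 0) ε) ε := by
    have hU := han.eventually_analyticAt
    have hd : DifferentiableOn ℂ (F 0) {z | AnalyticAt ℂ (F 0) z} :=
      fun z hz => hz.differentiableAt.differentiableWithinAt
    exact (((Complex.differentiableOn_dslope hU).2 hd) ε han).differentiableAt hU
  have hd : ∀ t θ, 0 < t → t ≤ ρ → r 0 ≤ θ → θ ≤ r (0 + 1) →
      DifferentiableAt ℂ (dslope (F 0) ε) (polar t θ) := by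
    intro t θ ht ht' h2 h3
    by_cases hz : polar t θ = ε
    · rw [hz]; exact hdε
    · exact (differentiableAt_dslope_of_ne hz).2
        (hF.analyticAt 0 hF.pos t θ ht ht' h2 h3).differentiableAt
  obtain ⟨d, hd0, hdb⟩ := Metric.continuousAt_iff.1 hdε.continuousAt 1 one_pos
  have hM : ∀ t θ, 0 < t → t ≤ ρ → r 0 ≤ θ → θ ≤ r (0 + 1) →
      ‖dslope (F 0) ε (polar t θ)‖ ≤ max (1 + ‖dslope (F 0) ε ε‖) (d⁻¹ * (M + ‖F 0 ε‖)) := by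
    intro t θ ht ht' h2 h3
    rcases lt_or_ge (dist (polar t θ) ε) d with h | h
    · refine le_trans ?_ (le_max_left _ _)
      have h4 := hdb h
      rw [dist_eq_norm] at h4
      have h5 := norm_sub_norm_le (dslope (F 0) ε (polar t θ)) (dslope (F 0) ε ε)
      linarith
    · refine le_trans ?_ (le_max_right _ _)
      have hne : polar t θ ≠ ε := fun h' => by
        rw [h', dist_self] at h; linarith
      rw [hDK _ hne, hK]
      refine norm_inv_smul_le hd0 (by rwa [← dist_eq_norm]) ((norm_sub_le _ _).trans ?_)
      exact add_le_add_left (hF.norm_le 0 hF.pos t θ ht ht' h2 h3) _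
  have := rayInt_sub_add_arcInt_eq_zero hF.radius_pos (hF.le_succ 0 hF.pos) hd hM
  rw [zero_add] at this
  rwa [rayInt_congr hF.radius_pos.le fun t ht _ => hDK _ (hr0 t ht),
    rayInt_congr hF.radius_pos.le fun t ht _ => hDK _ (hr1 t ht),
    arcInt_congr (hF.le_succ 0 hF.pos) fun θ _ _ => hDK _ (harc θ)] at this

/-- The kernel is regular and bounded on the later sectors, so any constant `v` may be subtracted;
the value needed is that of `F 0` at the pole. -/
lemma sector_succ [CompleteSpace E] (hF : IsSectorChain n r ρ M F) (h0 : r 0 < φ) (h1 : φ < r 1)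
    (hs : 0 < s) {k : ℕ} (hk : k + 1 < n) (v : E) {K : ℂ → E}
    (hK : K = fun ζ => (ζ - polar s φ)⁻¹ • (F (k + 1) ζ - v)) :
    rayInt K (r (k + 1)) 0 ρ - rayInt K (r (k + 2)) 0 ρ + arcInt K ρ (r (k + 1)) (r (k + 2)) =
      0 := by
  obtain ⟨c, hc, hcle⟩ := exists_le_norm_sub h0 h1 hs
  have hcθ : ∀ t θ, 0 < t → r (k + 1) ≤ θ → θ ≤ r (k + 1 + 1) →
      c ≤ ‖polar t θ - polar s φ‖ := fun t θ ht h2 h3 =>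
    hcle t θ ht.le ((hF.ray_mem (k := k) (by omega)).1.trans h2) (h3.trans (hF.ray_mem hk).2)
  refine rayInt_sub_add_arcInt_eq_zero (M := c⁻¹ * (M + ‖v‖)) hF.radius_pos (hF.le_succ _ hk) ?_ ?_
  · intro t θ ht ht' h2 h3
    have hne : polar t θ - polar s φ ≠ 0 := norm_pos_iff.1 (hc.trans_le (hcθ t θ ht h2 h3))
    have hA := (hF.analyticAt _ hk t θ ht ht' h2 h3).differentiableAt
    rw [hK]
    have hinv : DifferentiableAt ℂ (fun ζ => (ζ - polar s φ)⁻¹) (polar t θ) :=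
      (differentiableAt_id.sub_const _).inv hne
    exact hinv.smul (hA.sub_const v)
  · intro t θ ht ht' h2 h3
    rw [hK]
    refine norm_inv_smul_le hc (hcθ t θ ht h2 h3) ((norm_sub_le _ _).trans ?_)
    exact add_le_add_left (hF.norm_le _ hk t θ ht ht' h2 h3) _

/-- Cauchy's integral formula for a chain of sectors. -/
theorem chainInt_inv_sub [CompleteSpace E] (hF : IsSectorChain n r ρ M F) (h0 : r 0 < φ)
    (h1 : φ < r 1) (hs : 0 < s) (hsρ : s < ρ) :
    chainInt n r ρ F (fun ζ => (ζ - polar s φ)⁻¹) =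
      (2 * Real.pi * Complex.I : ℂ) • F 0 (polar s φ) := by
  set ε := polar s φ with hε
  set v := F 0 ε with hv
  have hρ := hF.radius_pos
  have hερ : ‖ε‖ < ρ := by rwa [hε, norm_polar hs.le]
  obtain ⟨c, hc, hcle⟩ := exists_le_norm_sub h0 h1 hs
  -- Subtracting the same `v` everywhere removes the pole, leaves the jumps unchanged, and reduces
  -- the residue to a scalar integral over the full circle.
  let K : ℕ → ℂ → E := fun k ζ => (ζ - ε)⁻¹ • (F k ζ - v)
  have harc : ∀ θ, polar ρ θ - ε ≠ 0 := fun θ h => by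
    have := congrArg norm (sub_eq_zero.1 h)
    rw [norm_polar hρ.le] at this
    linarith
  have hsec : ∀ k < n, rayInt (K k) (r k) 0 ρ - rayInt (K k) (r (k + 1)) 0 ρ +
      arcInt (K k) ρ (r k) (r (k + 1)) = 0 := by
    intro k hk
    cases k with
    | zero => exact hF.sector_zero h0 h1 hs hsρ rfl
    | succ k => exact hF.sector_succ h0 h1 hs hk v rfl
  have hint : ∀ G : ℂ → E, ∀ k < n, (∀ t, 0 < t → t ≤ ρ → ContinuousAt G (polar t (r (k + 1)))) →
      (∀ t, 0 < t → t ≤ ρ → ‖G (polar t (r (k + 1)))‖ ≤ M) →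
      IntervalIntegrable (fun t => Complex.exp ((r (k + 1) : ℂ) * Complex.I) •
        ((polar t (r (k + 1)) - ε)⁻¹ • (G (polar t (r (k + 1))) - v))) volume 0 ρ := by
    intro G k hk hGc hGM
    have hcr : ∀ t, 0 < t → c ≤ ‖polar t (r (k + 1)) - ε‖ := fun t ht =>
      hcle t _ ht.le (hF.ray_mem hk).1 (hF.ray_mem hk).2
    refine intervalIntegrable_ray (H := fun ζ => (ζ - ε)⁻¹ • (G ζ - v)) (M := c⁻¹ * (M + ‖v‖))
      hρ.le (continuousOn_comp_polar (H := fun ζ => (ζ - ε)⁻¹ • (G ζ - v)) fun t ht ht' => ?_)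
      fun t ht ht' => ?_
    · have hne : polar t (r (k + 1)) - ε ≠ 0 := norm_pos_iff.1 (hc.trans_le (hcr t ht))
      exact ((continuousAt_id.sub continuousAt_const).inv₀ hne).smul
        ((hGc t ht ht').sub continuousAt_const)
    · refine norm_inv_smul_le hc (hcr t ht) ((norm_sub_le _ _).trans ?_)
      exact add_le_add_left (hGM t ht ht') _
  have hray : ∀ k < n, rayInt (fun ζ => (ζ - ε)⁻¹ • (F (k + 1) ζ - F k ζ)) (r (k + 1)) 0 ρ =
      rayInt (K (k + 1)) (r (k + 1)) 0 ρ - rayInt (K k) (r (k + 1)) 0 ρ := by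
    intro k hk
    unfold rayInt
    rw [← intervalIntegral.integral_sub
      (hint (F (k + 1)) k hk (fun t ht ht' => (hF.analyticAt_next hk ht ht').continuousAt)
        fun t ht ht' => hF.norm_next_le hk ht ht')
      (hint (F k) k hk
        (fun t ht ht' => (hF.analyticAt k hk t _ ht ht' (hF.le_succ k hk) le_rfl).continuousAt)
        fun t ht ht' => hF.norm_le k hk t _ ht ht' (hF.le_succ k hk) le_rfl)]
    congr 1
    funext t
    rw [← smul_sub, ← smul_sub, sub_sub_sub_cancel_right]
  let J : ℝ → ℂ := fun θ => (Complex.I * polar ρ θ) * (polar ρ θ - ε)⁻¹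
  have hJ : Continuous J := (continuous_const.mul (continuous_polar_right ρ)).mul
    (((continuous_polar_right ρ).sub continuous_const).inv₀ harc)
  have harcK : ∀ k < n, arcInt (fun ζ => (ζ - ε)⁻¹ • F k ζ) ρ (r k) (r (k + 1)) =
      arcInt (K k) ρ (r k) (r (k + 1)) + (∫ θ in r k..r (k + 1), J θ) • v := by
    intro k hk
    rw [← intervalIntegral.integral_smul_const]
    unfold arcInt
    rw [← intervalIntegral.integral_add]
    · refine intervalIntegral.integral_congr fun θ _ => ?_
      simp only [K, J]
      rw [mul_smul _ _ v, ← smul_add, ← smul_add, sub_add_cancel]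
    · refine intervalIntegrable_arc (H := K k) (hF.le_succ k hk) fun θ h2 h3 => ?_
      exact ((continuousAt_id.sub continuousAt_const).inv₀ (harc θ)).smul
        ((hF.analyticAt k hk ρ θ hρ le_rfl h2 h3).continuousAt.sub continuousAt_const)
    · exact (hJ.smul continuous_const).intervalIntegrable _ _
  have hstep : ∀ k ∈ Finset.range n, (arcInt (fun ζ => (ζ - ε)⁻¹ • F k ζ) ρ (r k) (r (k + 1)) +
      rayInt (fun ζ => (ζ - ε)⁻¹ • (F (k + 1) ζ - F k ζ)) (r (k + 1)) 0 ρ) =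
      (∫ θ in r k..r (k + 1), J θ) • v +
        (rayInt (K (k + 1)) (r (k + 1)) 0 ρ - rayInt (K k) (r k) 0 ρ) := by
    intro k hk
    rw [Finset.mem_range] at hk
    rw [harcK k hk, hray k hk]
    have := hsec k hk
    rw [← sub_eq_zero, ← this]
    abel
  unfold chainInt
  -- The ray integrals telescope, and the arcs of `J` join into one full turn.
  rw [Finset.sum_congr rfl hstep, Finset.sum_add_distrib,
    Finset.sum_range_sub (fun k => rayInt (K k) (r k) 0 ρ), ← Finset.sum_smul,
    intervalIntegral.sum_integral_adjacent_intervals fun k _ => hJ.intervalIntegrable _ _,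
    hF.turn, integral_arc_inv_sub hερ]
  have hclose : rayInt (K n) (r 0 + 2 * Real.pi) 0 ρ = rayInt (K 0) (r 0) 0 ρ := by
    simp only [rayInt, K, hF.periodic, polar_add_two_pi]
    congr 1
    funext t
    congr 1
    have := polar_add_two_pi 1 (r 0)
    simpa [polar] using this
  rw [hclose, sub_self, add_zero]

end Point

end IsSectorChain

/-! ### Flat jumps, the coefficients and the remainder -/

/-- Completing the square in `log t`; the extremum is at `log t = -Λm`. -/
lemma inv_pow_mul_exp_neg_log_sq_le {Λ t : ℝ} (hΛ : 0 < Λ) (ht : 0 < t) (m : ℕ) :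
    (t ^ m)⁻¹ * Real.exp (-(Real.log t ^ 2 / (2 * Λ))) ≤ Real.exp (Λ * (m : ℝ) ^ 2 / 2) := by
  have h : (t ^ m)⁻¹ = Real.exp (-(m * Real.log t)) := by
    rw [Real.exp_neg, Real.exp_nat_mul, Real.exp_log ht]
  rw [h, ← Real.exp_add, Real.exp_le_exp]
  have h2 : Λ * (m : ℝ) ^ 2 / 2 - (-(m * Real.log t) + -(Real.log t ^ 2 / (2 * Λ))) =
      (Real.log t + Λ * m) ^ 2 / (2 * Λ) := by
    field_simp
    ring
  have h3 : 0 ≤ (Real.log t + Λ * m) ^ 2 / (2 * Λ) := by positivity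
  linarith

/-- The kernels for which the contour integrals of `chainInt` converge. -/
structure IsChainKernel (n : ℕ) (r : ℕ → ℝ) (ρ : ℝ) (h : ℂ → ℂ) : Prop where
  arc : ∀ θ, ContinuousAt h (polar ρ θ)
  ray : ∀ k < n, ∀ t, 0 < t → t ≤ ρ → ContinuousAt h (polar t (r (k + 1)))
  bound : ∃ (B : ℝ) (m : ℕ), ∀ k < n, ∀ t, 0 < t → t ≤ ρ →
    ‖h (polar t (r (k + 1)))‖ ≤ B * (t ^ m)⁻¹

namespace IsSectorChain

variable {n : ℕ} {r : ℕ → ℝ} {ρ M D Λ : ℝ} {F : ℕ → ℂ → E}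

/-- The jumps of `F` along the rays are flat. -/
def HasFlatJumps (n : ℕ) (r : ℕ → ℝ) (ρ D Λ : ℝ) (F : ℕ → ℂ → E) : Prop :=
  ∀ k < n, ∀ t, 0 < t → t ≤ ρ →
    ‖F (k + 1) (polar t (r (k + 1))) - F k (polar t (r (k + 1)))‖ ≤
      D * Real.exp (-(Real.log t ^ 2 / (2 * Λ)))

lemma norm_kernel_smul_jump_le (hF : HasFlatJumps n r ρ D Λ F) (hΛ : 0 < Λ) {h : ℂ → ℂ} {B : ℝ}
    {m : ℕ} {k : ℕ} (hk : k < n) {t : ℝ} (ht : 0 < t) (ht' : t ≤ ρ)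
    (hB : ‖h (polar t (r (k + 1)))‖ ≤ B * (t ^ m)⁻¹) :
    ‖h (polar t (r (k + 1))) •
      (F (k + 1) (polar t (r (k + 1))) - F k (polar t (r (k + 1))))‖ ≤
      B * D * Real.exp (Λ * (m : ℝ) ^ 2 / 2) := by
  have hjump := hF k hk t ht ht'
  have hD : 0 ≤ D := by
    by_contra hD
    have := mul_neg_of_neg_of_pos (not_le.1 hD) (Real.exp_pos (-(Real.log t ^ 2 / (2 * Λ))))
    linarith [norm_nonneg (F (k + 1) (polar t (r (k + 1))) - F k (polar t (r (k + 1))))]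
  have hB0 : 0 ≤ B := by
    have h1 : 0 < (t ^ m)⁻¹ := by positivity
    by_contra hB0
    have := mul_neg_of_neg_of_pos (not_le.1 hB0) h1
    linarith [norm_nonneg (h (polar t (r (k + 1))))]
  rw [norm_smul]
  calc _ ≤ (B * (t ^ m)⁻¹) * (D * Real.exp (-(Real.log t ^ 2 / (2 * Λ)))) :=
        mul_le_mul hB hjump (norm_nonneg _) (by positivity)
    _ = B * D * ((t ^ m)⁻¹ * Real.exp (-(Real.log t ^ 2 / (2 * Λ)))) := by ring
    _ ≤ _ := mul_le_mul_of_nonneg_left (inv_pow_mul_exp_neg_log_sq_le hΛ ht m) (by positivity)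

lemma intervalIntegrable_kernel_ray (hF : IsSectorChain n r ρ M F)
    (hJ : HasFlatJumps n r ρ D Λ F) (hΛ : 0 < Λ) {h : ℂ → ℂ} (hh : IsChainKernel n r ρ h) {k : ℕ}
    (hk : k < n) :
    IntervalIntegrable (fun t => Complex.exp ((r (k + 1) : ℂ) * Complex.I) •
      (h (polar t (r (k + 1))) •
        (F (k + 1) (polar t (r (k + 1))) - F k (polar t (r (k + 1)))))) volume 0 ρ := by
  obtain ⟨B, m, hB⟩ := hh.bound
  refine intervalIntegrable_ray (H := fun ζ => h ζ • (F (k + 1) ζ - F k ζ))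
    hF.radius_pos.le (continuousOn_comp_polar (H := fun ζ => h ζ • (F (k + 1) ζ - F k ζ))
      fun t ht ht' => ?_)
    (fun t ht ht' => norm_kernel_smul_jump_le hJ hΛ hk ht ht' (hB k hk t ht ht'))
  exact (hh.ray k hk t ht ht').smul ((hF.analyticAt_next hk ht ht').continuousAt.sub
    (hF.analyticAt k hk t _ ht ht' (hF.le_succ k hk) le_rfl).continuousAt)

lemma intervalIntegrable_kernel_arc (hF : IsSectorChain n r ρ M F) {h : ℂ → ℂ}
    (hh : IsChainKernel n r ρ h) {k : ℕ} (hk : k < n) :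
    IntervalIntegrable (fun θ => (Complex.I * polar ρ θ) • (h (polar ρ θ) • F k (polar ρ θ)))
      volume (r k) (r (k + 1)) :=
  intervalIntegrable_arc (H := fun ζ => h ζ • F k ζ) (hF.le_succ k hk) fun θ h2 h3 =>
    (hh.arc θ).smul (hF.analyticAt k hk ρ θ hF.radius_pos le_rfl h2 h3).continuousAt

/-- Linearity is asked for on the contour only, since the kernel identity to which it is applied
fails at `0` and at the pole. -/
lemma chainInt_eq_smul_add (hF : IsSectorChain n r ρ M F) (hJ : HasFlatJumps n r ρ D Λ F)
    (hΛ : 0 < Λ) {h h₁ h₂ : ℂ → ℂ} (hh₁ : IsChainKernel n r ρ h₁) (hh₂ : IsChainKernel n r ρ h₂)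
    (c : ℂ) (harc : ∀ θ, h (polar ρ θ) = c * h₁ (polar ρ θ) + h₂ (polar ρ θ))
    (hray : ∀ k < n, ∀ t, 0 < t → t ≤ ρ →
      h (polar t (r (k + 1))) = c * h₁ (polar t (r (k + 1))) + h₂ (polar t (r (k + 1)))) :
    chainInt n r ρ F h = c • chainInt n r ρ F h₁ + chainInt n r ρ F h₂ := by
  unfold chainInt
  rw [Finset.smul_sum, ← Finset.sum_add_distrib]
  refine Finset.sum_congr rfl fun k hk => ?_
  rw [Finset.mem_range] at hk
  have h1 : arcInt (fun ζ => h ζ • F k ζ) ρ (r k) (r (k + 1)) =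
      c • arcInt (fun ζ => h₁ ζ • F k ζ) ρ (r k) (r (k + 1)) +
        arcInt (fun ζ => h₂ ζ • F k ζ) ρ (r k) (r (k + 1)) := by
    unfold arcInt
    rw [← intervalIntegral.integral_smul]
    refine Eq.trans ?_ (intervalIntegral.integral_add
      ((hF.intervalIntegrable_kernel_arc hh₁ hk).smul c) (hF.intervalIntegrable_kernel_arc hh₂ hk))
    refine intervalIntegral.integral_congr fun θ _ => ?_
    simp only [harc θ]
    module
  have h2 : rayInt (fun ζ => h ζ • (F (k + 1) ζ - F k ζ)) (r (k + 1)) 0 ρ =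
      c • rayInt (fun ζ => h₁ ζ • (F (k + 1) ζ - F k ζ)) (r (k + 1)) 0 ρ +
        rayInt (fun ζ => h₂ ζ • (F (k + 1) ζ - F k ζ)) (r (k + 1)) 0 ρ := by
    rw [rayInt_congr (K := fun ζ => (c * h₁ ζ + h₂ ζ) • (F (k + 1) ζ - F k ζ)) hF.radius_pos.le
      fun t ht ht' => by simp only [hray k hk t ht ht']]
    unfold rayInt
    rw [← intervalIntegral.integral_smul]
    refine Eq.trans ?_ (intervalIntegral.integral_add
      ((hF.intervalIntegrable_kernel_ray hJ hΛ hh₁ hk).smul c)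
      (hF.intervalIntegrable_kernel_ray hJ hΛ hh₂ hk))
    refine intervalIntegral.integral_congr fun t _ => ?_
    dsimp only [Pi.smul_apply]
    module
  rw [h1, h2]
  module

/-- The arcs use only boundedness of the `F k`, with `2π` as a crude bound for each opening; the
rays use flatness against the pole of order `m`. -/
lemma norm_chainInt_le (hF : IsSectorChain n r ρ M F) (hJ : HasFlatJumps n r ρ D Λ F)
    (hΛ : 0 < Λ) {h : ℂ → ℂ} {B₁ B₂ : ℝ} {m : ℕ} (hB₁ : 0 ≤ B₁)
    (harc : ∀ θ, ‖h (polar ρ θ)‖ ≤ B₁)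
    (hray : ∀ k < n, ∀ t, 0 < t → t ≤ ρ → ‖h (polar t (r (k + 1)))‖ ≤ B₂ * (t ^ m)⁻¹) :
    ‖chainInt n r ρ F h‖ ≤
      n * (ρ * (B₁ * M) * (2 * Real.pi) + B₂ * D * Real.exp (Λ * (m : ℝ) ^ 2 / 2) * ρ) := by
  have hρ := hF.radius_pos
  have hM := hF.bound_nonneg
  unfold chainInt
  refine (norm_sum_le_of_le _ (fun k hk => ?_)).trans_eq
    ((Finset.sum_const _).trans (by rw [Finset.card_range, nsmul_eq_mul]))
  rw [Finset.mem_range] at hk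
  refine (norm_add_le _ _).trans (add_le_add ?_ ?_)
  · have hle := hF.le_succ k hk
    have h1 : ‖arcInt (fun ζ => h ζ • F k ζ) ρ (r k) (r (k + 1))‖ ≤
        ρ * (B₁ * M) * |r (k + 1) - r k| := by
      refine intervalIntegral.norm_integral_le_of_norm_le_const fun θ hθ => ?_
      rw [uIoc_of_le hle] at hθ
      rw [norm_smul, norm_mul, Complex.norm_I, one_mul, norm_polar hρ.le, norm_smul]
      exact mul_le_mul_of_nonneg_left (mul_le_mul (harc θ)
        (hF.norm_le k hk ρ θ hρ le_rfl hθ.1.le hθ.2) (norm_nonneg _) hB₁) hρ.le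
    refine h1.trans (mul_le_mul_of_nonneg_left ?_ (by positivity))
    rw [abs_of_nonneg (sub_nonneg.2 hle)]
    have h2 := (hF.ray_mem hk).2
    have h3 : r 0 ≤ r k := by
      cases k with
      | zero => exact le_rfl
      | succ k => exact (hF.le_succ 0 hF.pos).trans (hF.ray_mem (k := k) (by omega)).1
    linarith
  · have h1 : ‖rayInt (fun ζ => h ζ • (F (k + 1) ζ - F k ζ)) (r (k + 1)) 0 ρ‖ ≤
        B₂ * D * Real.exp (Λ * (m : ℝ) ^ 2 / 2) * |ρ - 0| := by
      refine intervalIntegral.norm_integral_le_of_norm_le_const fun t ht => ?_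
      rw [uIoc_of_le hρ.le] at ht
      rw [norm_smul, Complex.norm_exp_ofReal_mul_I, one_mul]
      exact norm_kernel_smul_jump_le hJ hΛ hk ht.1 ht.2 (hray k hk t ht.1 ht.2)
    rwa [sub_zero, abs_of_pos hρ] at h1

/-- The coefficients of the asymptotic expansion of `F 0`. -/
noncomputable def coeff (n : ℕ) (r : ℕ → ℝ) (ρ : ℝ) (F : ℕ → ℂ → E) (m : ℕ) : E :=
  (2 * Real.pi * Complex.I : ℂ)⁻¹ • chainInt n r ρ F fun ζ => (ζ ^ (m + 1))⁻¹

/-- The Cauchy kernel minus its expansion of order `N` at the origin. -/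
noncomputable def cauchyRemainder (ε : ℂ) (N : ℕ) (ζ : ℂ) : ℂ := ε ^ N * (ζ ^ N)⁻¹ * (ζ - ε)⁻¹

lemma cauchyRemainder_eq {ε ζ : ℂ} (N : ℕ) (h0 : ζ ≠ 0) (hε : ζ - ε ≠ 0) :
    cauchyRemainder ε N ζ = ε ^ N * (ζ ^ (N + 1))⁻¹ + cauchyRemainder ε (N + 1) ζ := by
  unfold cauchyRemainder
  field_simp
  ring

lemma isChainKernel_inv_pow (hρ : 0 < ρ) (m : ℕ) : IsChainKernel n r ρ fun ζ => (ζ ^ m)⁻¹ where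
  arc θ := (continuousAt_id.pow m).inv₀ (pow_ne_zero _ (polar_ne_zero hρ θ))
  ray k _ t ht _ := (continuousAt_id.pow m).inv₀ (pow_ne_zero _ (polar_ne_zero ht _))
  bound := ⟨1, m, fun k _ t ht _ => by rw [norm_inv, norm_pow, norm_polar ht.le, one_mul]⟩

section Point

variable {s φ c : ℝ}

/-- Bounding `|ζ - ε|` below by `|ζ|` instead of `|ε|` spends one more power of `t`, which flatness
pays for, and loses no power of `s`. -/
lemma norm_cauchyRemainder_ray_le (hs : 0 ≤ s) (hc : 0 < c) (N : ℕ) {t θ : ℝ} (ht : 0 < t)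
    (h : c * t ≤ ‖polar t θ - polar s φ‖) :
    ‖cauchyRemainder (polar s φ) N (polar t θ)‖ ≤ s ^ N * c⁻¹ * (t ^ (N + 1))⁻¹ := by
  unfold cauchyRemainder
  rw [norm_mul, norm_mul, norm_pow, norm_inv, norm_inv, norm_pow, norm_polar hs, norm_polar ht.le]
  calc _ ≤ s ^ N * (t ^ N)⁻¹ * (c * t)⁻¹ :=
        mul_le_mul_of_nonneg_left (inv_anti₀ (by positivity) h) (by positivity)
    _ = _ := by rw [mul_inv, pow_succ, mul_inv]; ring

lemma le_norm_arc_sub (hs : 0 ≤ s) (hρ : 0 ≤ ρ) (θ : ℝ) :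
    ρ - s ≤ ‖polar ρ θ - polar s φ‖ := by
  have := norm_sub_norm_le (polar ρ θ) (polar s φ)
  rwa [norm_polar hs, norm_polar hρ] at this

lemma isChainKernel_cauchyRemainder (hs : 0 ≤ s) (hsρ : s < ρ) (hc : 0 < c)
    (hray : ∀ k < n, ∀ t, 0 < t → c * t ≤ ‖polar t (r (k + 1)) - polar s φ‖) (N : ℕ) :
    IsChainKernel n r ρ (cauchyRemainder (polar s φ) N) := by
  have hρ : 0 < ρ := hs.trans_lt hsρ
  have hcont : ∀ ζ, ζ ≠ 0 → ζ - polar s φ ≠ 0 →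
      ContinuousAt (cauchyRemainder (polar s φ) N) ζ := fun ζ h1 h2 =>
    (continuousAt_const.mul ((continuousAt_id.pow N).inv₀ (pow_ne_zero _ h1))).mul
      ((continuousAt_id.sub continuousAt_const).inv₀ h2)
  refine ⟨fun θ => hcont _ (polar_ne_zero hρ θ) ?_, fun k hk t ht ht' =>
    hcont _ (polar_ne_zero ht _) ?_, s ^ N * c⁻¹, N + 1, fun k hk t ht ht' =>
      norm_cauchyRemainder_ray_le hs hc N ht (hray k hk t ht)⟩
  · exact norm_pos_iff.1 ((sub_pos.2 hsρ).trans_le (le_norm_arc_sub hs hρ.le θ))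
  · exact norm_pos_iff.1 ((mul_pos hc ht).trans_le (hray k hk t ht))

/-- For `N = 0` this is Cauchy's formula; each further step splits one term off the geometric
expansion of the kernel. -/
lemma sub_sum_eq_chainInt [CompleteSpace E] (hF : IsSectorChain n r ρ M F)
    (hJ : HasFlatJumps n r ρ D Λ F) (hΛ : 0 < Λ) (h0 : r 0 < φ) (h1 : φ < r 1) (hs : 0 < s)
    (hsρ : s < ρ) (hc : 0 < c)
    (hray : ∀ k < n, ∀ t, 0 < t → c * t ≤ ‖polar t (r (k + 1)) - polar s φ‖) (N : ℕ) :
    F 0 (polar s φ) - ∑ m ∈ Finset.range N, polar s φ ^ m • coeff n r ρ F m =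
      (2 * Real.pi * Complex.I : ℂ)⁻¹ •
        chainInt n r ρ F (cauchyRemainder (polar s φ) N) := by
  have hρ := hF.radius_pos
  induction N with
  | zero =>
    have hfun : cauchyRemainder (polar s φ) 0 = fun ζ => (ζ - polar s φ)⁻¹ := by
      funext ζ; simp [cauchyRemainder]
    rw [hfun, hF.chainInt_inv_sub h0 h1 hs hsρ, smul_smul,
      inv_mul_cancel₀ Complex.two_pi_I_ne_zero]
    simp
  | succ N ih =>
    rw [Finset.sum_range_succ, ← sub_sub, ih,
      hF.chainInt_eq_smul_add hJ hΛ (isChainKernel_inv_pow hρ (N + 1))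
        (isChainKernel_cauchyRemainder hs.le hsρ hc hray (N + 1)) (polar s φ ^ N)
        (fun θ => cauchyRemainder_eq N (polar_ne_zero hρ θ)
          (norm_pos_iff.1 ((sub_pos.2 hsρ).trans_le (le_norm_arc_sub hs.le hρ.le θ))))
        (fun k hk t ht _ => cauchyRemainder_eq N (polar_ne_zero ht _)
          (norm_pos_iff.1 ((mul_pos hc ht).trans_le (hray k hk t ht)))), coeff]
    module

end Point

/-- The expansion of `F 0` on the proper subsectors of the first sector. -/
theorem exists_expansion [CompleteSpace E] (hF : IsSectorChain n r ρ M F)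
    (hJ : HasFlatJumps n r ρ D Λ F) (hΛ : 0 < Λ) {a₁ b₁ ρ₁ : ℝ} (ha : r 0 < a₁) (hb : b₁ < r 1)
    (hρ₁ : ρ₁ < ρ) :
    ∃ C H : ℝ, 0 < C ∧ 0 < H ∧ ∀ N : ℕ, ∀ ε ∈ sector a₁ b₁ ρ₁,
      ‖F 0 ε - ∑ m ∈ Finset.range (N + 1), ε ^ m • coeff n r ρ F m‖ ≤
        C * H ^ N * Real.exp (Λ * (N : ℝ) ^ 2 / 2) * ‖ε‖ ^ (N + 1) := by
  have hρ := hF.radius_pos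
  have hM := hF.bound_nonneg
  have hD : 0 ≤ D := by
    by_contra hD
    have h1 := hJ 0 hF.pos ρ hρ le_rfl
    have := mul_neg_of_neg_of_pos (not_le.1 hD) (Real.exp_pos (-(Real.log ρ ^ 2 / (2 * Λ))))
    linarith [norm_nonneg (F (0 + 1) (polar ρ (r (0 + 1))) - F 0 (polar ρ (r (0 + 1))))]
  -- The arguments of the rays lie in `[r 1, r 0 + 2π]`, those of the subsector in `(a₁, b₁)`.
  obtain ⟨c, hc, hdist⟩ := exists_mul_le_norm_polar_sub_polar (ψ₀ := r 1 - b₁)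
    (ψ₁ := r 0 + 2 * Real.pi - a₁) (by linarith) (by linarith)
  -- `A₁` collects the arcs and `A₂` the rays; of the two entries of `H`, `ρ⁻¹` serves the arcs and
  -- `exp (2Λ)` the rays.
  set A₁ : ℝ := (2 * Real.pi)⁻¹ * (n * (ρ * ((ρ⁻¹ * (ρ - ρ₁)⁻¹) * M) * (2 * Real.pi))) with hA₁
  set A₂ : ℝ := (2 * Real.pi)⁻¹ * (n * (c⁻¹ * D * Real.exp (2 * Λ) * ρ)) with hA₂
  have hsub : 0 < ρ - ρ₁ := sub_pos.2 hρ₁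
  have hA₁0 : 0 ≤ A₁ := by have := Real.pi_pos; positivity
  have hA₂0 : 0 ≤ A₂ := by have := Real.pi_pos; positivity
  set H : ℝ := max ρ⁻¹ (Real.exp (2 * Λ)) with hH
  have hH0 : 0 < H := lt_max_of_lt_right (Real.exp_pos _)
  refine ⟨A₁ + A₂ + 1, H, by positivity, hH0, ?_⟩
  rintro N ε ⟨s, φ, hs, hsρ₁, hφ, hφ', rfl⟩
  change ‖F 0 (polar s φ) - ∑ m ∈ Finset.range (N + 1), polar s φ ^ m • coeff n r ρ F m‖ ≤
    _ * ‖polar s φ‖ ^ (N + 1)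
  have hsρ : s < ρ := hsρ₁.trans hρ₁
  have hray : ∀ k < n, ∀ t, 0 < t → c * t ≤ ‖polar t (r (k + 1)) - polar s φ‖ :=
    fun k hk t ht => (hdist t s _ φ ht.le hs.le (by linarith [(hF.ray_mem hk).1])
      (by linarith [(hF.ray_mem hk).2])).1
  rw [hF.sub_sum_eq_chainInt hJ hΛ (ha.trans hφ) (hφ'.trans hb) hs hsρ hc hray, norm_smul,
    norm_polar hs.le]
  have hbound := hF.norm_chainInt_le hJ hΛ (h := cauchyRemainder (polar s φ) (N + 1))
    (B₁ := s ^ (N + 1) * (ρ ^ (N + 1))⁻¹ * (ρ - ρ₁)⁻¹) (B₂ := s ^ (N + 1) * c⁻¹) (m := N + 1 + 1)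
    (by positivity)
    (fun θ => by
      unfold cauchyRemainder
      rw [norm_mul, norm_mul, norm_pow, norm_inv, norm_inv, norm_pow, norm_polar hs.le,
        norm_polar hρ.le]
      refine mul_le_mul_of_nonneg_left (inv_anti₀ hsub ?_) (by positivity)
      exact (sub_le_sub_left hsρ₁.le ρ).trans (le_norm_arc_sub hs.le hρ.le θ))
    (fun k hk t ht _ => norm_cauchyRemainder_ray_le hs.le hc _ ht (hray k hk t ht))
  have h2pi : ‖(2 * Real.pi * Complex.I : ℂ)⁻¹‖ = (2 * Real.pi)⁻¹ := by
    simp [abs_of_pos Real.pi_pos]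
  -- The pole has order `N + 2`, and `(N + 2)² = N² + 4N + 4`: the shift costs only a geometric
  -- factor.
  have hexp : Real.exp (Λ * ((N + 1 + 1 : ℕ) : ℝ) ^ 2 / 2) =
      Real.exp (2 * Λ) * Real.exp (2 * Λ) ^ N * Real.exp (Λ * (N : ℝ) ^ 2 / 2) := by
    rw [← Real.exp_nat_mul, ← Real.exp_add, ← Real.exp_add]
    congr 1
    push_cast
    ring
  have hHN : (ρ⁻¹) ^ N ≤ H ^ N := pow_le_pow_left₀ (by positivity) (le_max_left _ _) N
  have hHN' : Real.exp (2 * Λ) ^ N ≤ H ^ N := pow_le_pow_left₀ (by positivity) (le_max_right _ _) N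
  have hexp1 : 1 ≤ Real.exp (Λ * (N : ℝ) ^ 2 / 2) := Real.one_le_exp (by positivity)
  rw [h2pi]
  refine (mul_le_mul_of_nonneg_left hbound (by have := Real.pi_pos; positivity)).trans ?_
  rw [hexp]
  calc _ = (A₁ * (ρ⁻¹) ^ N * 1 +
        A₂ * Real.exp (2 * Λ) ^ N * Real.exp (Λ * (N : ℝ) ^ 2 / 2)) * s ^ (N + 1) := by
        rw [hA₁, hA₂, inv_pow, pow_succ ρ, mul_inv]
        ring
    _ ≤ (A₁ * H ^ N * Real.exp (Λ * (N : ℝ) ^ 2 / 2) +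
        A₂ * H ^ N * Real.exp (Λ * (N : ℝ) ^ 2 / 2)) * s ^ (N + 1) := by
        gcongr
    _ ≤ _ := by
        refine mul_le_mul_of_nonneg_right ?_ (by positivity)
        have : 0 ≤ H ^ N * Real.exp (Λ * (N : ℝ) ^ 2 / 2) := by positivity
        linarith

end IsSectorChain

/-! ### Sectors, lifted coverings and the common expansion -/

lemma polar_mem_sector {a b ρ t θ : ℝ} (ht : 0 < t) (ht' : t < ρ) (ha : a < θ) (hb : θ < b) :
    polar t θ ∈ sector a b ρ :=
  ⟨t, θ, ht, ht', ha, hb, rfl⟩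

lemma sector_subset_sector {a b ρ a' b' ρ' : ℝ} (ha : a' ≤ a) (hb : b ≤ b') (hρ : ρ ≤ ρ') :
    sector a b ρ ⊆ sector a' b' ρ' := by
  rintro _ ⟨t, θ, h1, h2, h3, h4, rfl⟩
  exact ⟨t, θ, h1, h2.trans_le hρ, ha.trans_lt h3, h4.trans_le hb, rfl⟩

lemma isOpen_sector (a b ρ : ℝ) : IsOpen (sector a b ρ) := by
  rcases le_or_gt ρ 0 with hρ | hρ
  · have : sector a b ρ = ∅ := by
      ext z
      simp only [mem_empty_iff_false, iff_false]
      rintro ⟨t, θ, h1, h2, -⟩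
      linarith
    rw [this]
    exact isOpen_empty
  have h : sector a b ρ = Complex.exp '' (Iio (Real.log ρ) ×ℂ Ioo a b) := by
    ext z
    constructor
    · rintro ⟨t, θ, h1, h2, h3, h4, rfl⟩
      exact ⟨⟨Real.log t, θ⟩, ⟨Real.log_lt_log h1 h2, h3, h4⟩, by
        rw [← polar, ← exp_log_add h1, Complex.mk_eq_add_mul_I]⟩
    · rintro ⟨w, ⟨h1, h2, h3⟩, rfl⟩
      refine ⟨Real.exp w.re, w.im, Real.exp_pos _, (Real.lt_log_iff_exp_lt hρ).1 h1, h2, h3, ?_⟩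
      conv_lhs => rw [← Complex.re_add_im w]
      rw [Complex.exp_add, Complex.ofReal_exp]
  rw [h]
  exact Complex.isOpenMap_exp _ (isOpen_Iio.reProdIm isOpen_Ioo)

/-- Moduli below `δ` are covered by the assumed bound, the others by compactness. -/
lemma exists_norm_le_of_sector {V : Type*} [NormedAddCommGroup V] {f : ℂ → V}
    {a b ε₀ α β ρ δ M : ℝ} (hf : ContinuousOn f (sector a b ε₀)) (hδ : 0 < δ)
    (hM : ∀ ε ∈ sector a b ε₀, ‖ε‖ < δ → ‖f ε‖ ≤ M) (hα : a < α) (hβ : β < b) (hρ : ρ < ε₀) :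
    ∃ M' : ℝ, ∀ t θ, 0 < t → t ≤ ρ → α ≤ θ → θ ≤ β → ‖f (polar t θ)‖ ≤ M' := by
  have hK : IsCompact (Icc δ ρ ×ˢ Icc α β) := isCompact_Icc.prod isCompact_Icc
  have hmem : ∀ t θ, 0 < t → t ≤ ρ → α ≤ θ → θ ≤ β → polar t θ ∈ sector a b ε₀ :=
    fun t θ h1 h2 h3 h4 =>
      polar_mem_sector h1 (h2.trans_lt hρ) (hα.trans_le h3) (h4.trans_lt hβ)
  obtain ⟨M₁, hM₁⟩ := hK.exists_bound_of_continuousOn (f := fun p => f (polar p.1 p.2))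
    (hf.comp continuous_polar.continuousOn fun p hp =>
      hmem _ _ (hδ.trans_le hp.1.1) hp.1.2 hp.2.1 hp.2.2)
  refine ⟨max M M₁, fun t θ h1 h2 h3 h4 => ?_⟩
  rcases lt_or_ge t δ with h | h
  · exact (hM _ (hmem t θ h1 h2 h3 h4) (by rwa [norm_polar h1.le])).trans (le_max_left _ _)
  · exact (hM₁ (t, θ) ⟨⟨h, h2⟩, h3, h4⟩).trans (le_max_right _ _)

/-- A family of functions on sectors indexed by `ℕ`, which turns once around the origin in `n`
steps, with bounded members and flat differences of consecutive members. -/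
structure IsLiftedCovering (n : ℕ) (A B : ℕ → ℝ) (ε₀ Λ : ℝ) (F : ℕ → ℂ → E) : Prop where
  pos : 0 < n
  radius_pos : 0 < ε₀
  mono_left : Monotone A
  mono_right : Monotone B
  turn_left : ∀ k, A (k + n) = A k + 2 * Real.pi
  turn_right : ∀ k, B (k + n) = B k + 2 * Real.pi
  periodic : ∀ k, F (k + n) = F k
  width : ∀ k, B k ≤ A k + 2 * Real.pi
  overlap : ∀ k, A (k + 1) < B k
  differentiableOn : ∀ k, DifferentiableOn ℂ (F k) (sector (A k) (B k) ε₀)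
  bounded : ∀ k, ∃ δ M : ℝ, 0 < δ ∧ ∀ ε ∈ sector (A k) (B k) ε₀, ‖ε‖ < δ → ‖F k ε‖ ≤ M
  jump : ∀ k, ∃ D : ℝ, ∀ t θ, 0 < t → t < ε₀ → A (k + 1) < θ → θ < B k →
    ‖F (k + 1) (polar t θ) - F k (polar t θ)‖ ≤ D * Real.exp (-(Real.log t ^ 2 / (2 * Λ)))

/-- The error bound of `q`-Gevrey type on `S`, without factorials. -/
def HasExpansionOn (Λ : ℝ) (f : ℂ → E) (g : ℕ → E) (S : Set ℂ) : Prop :=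
  ∃ C H : ℝ, 0 < C ∧ 0 < H ∧ ∀ N : ℕ, ∀ ε ∈ S,
    ‖f ε - ∑ m ∈ Finset.range (N + 1), ε ^ m • g m‖ ≤
      C * H ^ N * Real.exp (Λ * (N : ℝ) ^ 2 / 2) * ‖ε‖ ^ (N + 1)

lemma HasExpansionOn.mono {Λ : ℝ} {f : ℂ → E} {g : ℕ → E} {S T : Set ℂ}
    (h : HasExpansionOn Λ f g T) (hST : S ⊆ T) : HasExpansionOn Λ f g S := by
  obtain ⟨C, H, hC, hH, hb⟩ := h
  exact ⟨C, H, hC, hH, fun N ε hε => hb N ε (hST hε)⟩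

/-- Once the lower coefficients vanish, divide by `t ^ N` and let `t → 0`; a single ray is enough.
-/
lemma eq_zero_of_norm_sum_le {c : ℕ → E} {θ : ℝ}
    (h : ∀ N : ℕ, ∃ K : ℝ, ∀ᶠ t in 𝓝[>] (0 : ℝ),
      ‖∑ m ∈ Finset.range (N + 1), polar t θ ^ m • c m‖ ≤ K * t ^ (N + 1)) (N : ℕ) : c N = 0 := by
  induction N using Nat.strong_induction_on with
  | _ N ih =>
    obtain ⟨K, hK⟩ := h N
    have hle : ∀ᶠ t in 𝓝[>] (0 : ℝ), ‖c N‖ ≤ K * t := by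
      filter_upwards [hK, self_mem_nhdsWithin] with t ht ht0
      have ht0' : 0 < t := ht0
      rw [Finset.sum_range_succ, Finset.sum_eq_zero fun m hm => by
        rw [ih m (Finset.mem_range.1 hm), smul_zero], zero_add, norm_smul, norm_pow,
        norm_polar ht0'.le, pow_succ] at ht
      have hp : 0 < t ^ N := pow_pos ht0' N
      refine le_of_mul_le_mul_left (ht.trans_eq ?_) hp
      ring
    have hlim : Tendsto (fun t : ℝ => K * t) (𝓝[>] 0) (𝓝 (K * 0)) :=
      ((continuous_const.mul continuous_id).tendsto 0).mono_left nhdsWithin_le_nhds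
    have := ge_of_tendsto hlim hle
    rw [mul_zero] at this
    exact norm_le_zero_iff.1 this

/-- Asymptotic expansions on sectors with a common direction are unique, up to flat functions. -/
lemma HasExpansionOn.unique {Λ : ℝ} {f f' : ℂ → E} {g g' : ℕ → E} {a b ρ a' b' ρ' θ : ℝ}
    (h : HasExpansionOn Λ f g (sector a b ρ)) (h' : HasExpansionOn Λ f' g' (sector a' b' ρ'))
    (hρ : 0 < ρ) (hρ' : 0 < ρ') (ha : a < θ) (hb : θ < b) (ha' : a' < θ) (hb' : θ < b')
    (hff : ∀ N : ℕ, ∃ K : ℝ, ∀ᶠ t in 𝓝[>] (0 : ℝ),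
      ‖f' (polar t θ) - f (polar t θ)‖ ≤ K * t ^ (N + 1)) : g = g' := by
  obtain ⟨C, H, -, -, hb⟩ := h
  obtain ⟨C', H', -, -, hb'⟩ := h'
  funext N
  rw [← sub_eq_zero]
  revert N
  refine eq_zero_of_norm_sum_le (c := fun m => g m - g' m) (θ := θ) fun N => ?_
  obtain ⟨K, hK⟩ := hff N
  refine ⟨C' * H' ^ N * Real.exp (Λ * (N : ℝ) ^ 2 / 2) + K +
    C * H ^ N * Real.exp (Λ * (N : ℝ) ^ 2 / 2), ?_⟩
  filter_upwards [hK, Ioo_mem_nhdsGT hρ, Ioo_mem_nhdsGT hρ'] with t ht h1 h2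
  have e1 := hb N _ (polar_mem_sector h1.1 h1.2 ha ‹_›)
  have e2 := hb' N _ (polar_mem_sector h2.1 h2.2 ha' ‹_›)
  rw [norm_polar h1.1.le] at e1 e2
  have heq : ∑ m ∈ Finset.range (N + 1), polar t θ ^ m • (g m - g' m) =
      (f' (polar t θ) - ∑ m ∈ Finset.range (N + 1), polar t θ ^ m • g' m) -
      (f' (polar t θ) - f (polar t θ)) -
      (f (polar t θ) - ∑ m ∈ Finset.range (N + 1), polar t θ ^ m • g m) := by
    simp only [smul_sub, Finset.sum_sub_distrib]
    abel
  rw [heq, add_mul, add_mul]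
  exact (norm_sub_le _ _).trans (add_le_add ((norm_sub_le _ _).trans (add_le_add e2 ht)) e1)

namespace IsLiftedCovering

variable {n : ℕ} {A B : ℕ → ℝ} {ε₀ Λ : ℝ} {F : ℕ → ℂ → E}

lemma shift (h : IsLiftedCovering n A B ε₀ Λ F) (i : ℕ) :
    IsLiftedCovering n (fun k => A (i + k)) (fun k => B (i + k)) ε₀ Λ (fun k => F (i + k)) where
  pos := h.pos
  radius_pos := h.radius_pos
  mono_left _ _ hkl := h.mono_left (by omega)
  mono_right _ _ hkl := h.mono_right (by omega)
  turn_left k := by simpa only [add_assoc] using h.turn_left (i + k)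
  turn_right k := by simpa only [add_assoc] using h.turn_right (i + k)
  periodic k := by simpa only [add_assoc] using h.periodic (i + k)
  width k := h.width (i + k)
  overlap k := h.overlap (i + k)
  differentiableOn k := h.differentiableOn (i + k)
  bounded k := h.bounded (i + k)
  jump k := h.jump (i + k)

/-- A single sector of opening at most `2π` cannot overlap its own translate by a full turn. -/
lemma one_lt (h : IsLiftedCovering n A B ε₀ Λ F) : 1 < n := by
  by_contra hn
  obtain rfl : n = 1 := by have := h.pos; omega
  linarith [h.turn_left 0, h.overlap 0, h.width 0]

/-- Rays in the overlaps of consecutive sectors that enclose a given proper subsector of the first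
sector. -/
lemma exists_rays (h : IsLiftedCovering n A B ε₀ Λ F) {a₁ b₁ : ℝ} (ha : A 0 < a₁) (hab : a₁ < b₁)
    (hb : b₁ < B 0) :
    ∃ r : ℕ → ℝ, r 0 < a₁ ∧ b₁ < r 1 ∧ r n = r 0 + 2 * Real.pi ∧
      (∀ k < n, r k ≤ r (k + 1)) ∧ (∀ k < n, A k < r k) ∧
      (∀ k < n, A (k + 1) < r (k + 1)) ∧ ∀ k < n, r (k + 1) < B k := by
  have hn := h.one_lt
  -- `x` lies in the first overlap beyond `b₁`. Below, `y` is chosen before `a₁` with `y + 2π` in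
  -- the last overlap.
  obtain ⟨x, hx, hxB⟩ := exists_between (max_lt hb (h.overlap 0))
  obtain ⟨hbx, hAx⟩ := max_lt_iff.1 hx
  have hlast : A n < B (n - 1) := by
    have := h.overlap (n - 1)
    rwa [Nat.sub_add_cancel h.pos] at this
  have hAn : A n = A 0 + 2 * Real.pi := by simpa using h.turn_left 0
  obtain ⟨y, hAy, hy⟩ := exists_between (lt_min ha (show A 0 < B (n - 1) - 2 * Real.pi by linarith))
  obtain ⟨hya, hyB⟩ := lt_min_iff.1 hy
  have hxy : x ≤ y + 2 * Real.pi := by linarith [h.width 0]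
  -- Midpoints of the overlaps, increasing because both ends are. Clamping them between `x` and `y +
  -- 2π` keeps them in their overlaps, as `x < B 0 ≤ B k` and `A (k + 1) ≤ A n < y + 2π`.
  let m : ℕ → ℝ := fun k => (A k + B (k - 1)) / 2
  have hm : Monotone m := fun k l hkl => by
    have h1 := h.mono_left hkl
    have h2 := h.mono_right (show k - 1 ≤ l - 1 by omega)
    simp only [m]
    linarith
  let r : ℕ → ℝ := fun k => if k = 0 then y else if n ≤ k then y + 2 * Real.pi else
    max x (min (m k) (y + 2 * Real.pi))
  have hr0 : r 0 = y := if_pos rfl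
  have hrn : r n = y + 2 * Real.pi := by simp [r, h.pos.ne']
  have hrk : ∀ k, k + 1 < n → r (k + 1) = max x (min (m (k + 1)) (y + 2 * Real.pi)) :=
    fun k hk => by simp [r, hk]
  have hup : ∀ k < n, A (k + 1) < r (k + 1) ∧ r (k + 1) < B k := by
    intro k hk
    rcases Nat.lt_or_ge (k + 1) n with h1 | h1
    · rw [hrk k h1]
      have ho := h.overlap k
      have hAk : A (k + 1) ≤ A n := h.mono_left h1.le
      have hBk : B 0 ≤ B k := h.mono_right (Nat.zero_le k)
      have hmk : m (k + 1) = (A (k + 1) + B k) / 2 := by simp [m]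
      exact ⟨lt_max_of_lt_right (lt_min (by linarith) (by linarith)),
        max_lt (by linarith) (min_lt_of_left_lt (by linarith))⟩
    · obtain rfl : n = k + 1 := by omega
      rw [hrn]
      simp only [Nat.add_sub_cancel] at hyB
      exact ⟨by linarith, by linarith⟩
  refine ⟨r, by rwa [hr0], ?_, by rw [hrn, hr0], ?_, ?_, fun k hk => (hup k hk).1,
    fun k hk => (hup k hk).2⟩
  · rw [hrk 0 hn]
    exact lt_max_of_lt_left hbx
  · intro k hk
    rcases Nat.lt_or_ge (k + 1) n with h1 | h1
    · rw [hrk k h1]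
      cases k with
      | zero =>
        rw [hr0]
        exact le_max_of_le_left (by linarith)
      | succ k =>
        rw [hrk k hk]
        exact max_le_max le_rfl (min_le_min (hm (by omega)) le_rfl)
    · obtain rfl : n = k + 1 := by omega
      rw [hrn]
      cases k with
      | zero => omega
      | succ k =>
        rw [hrk k hk]
        exact max_le hxy (min_le_right _ _)
  · intro k hk
    cases k with
    | zero => rwa [hr0]
    | succ k => exact (hup k (by omega)).1

lemma exists_chain [CompleteSpace E] (h : IsLiftedCovering n A B ε₀ Λ F) {a₁ b₁ ρ : ℝ}
    (ha : A 0 < a₁) (hab : a₁ < b₁) (hb : b₁ < B 0) (hρ : 0 < ρ) (hρε : ρ < ε₀) :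
    ∃ (r : ℕ → ℝ) (M D : ℝ), IsSectorChain n r ρ M F ∧
      IsSectorChain.HasFlatJumps n r ρ D Λ F ∧ r 0 < a₁ ∧ b₁ < r 1 := by
  obtain ⟨r, hr0, hr1, hrn, hmono, hA, hA', hB⟩ := h.exists_rays ha hab hb
  have hbd : ∀ k, ∃ M : ℝ, k < n → ∀ t θ, 0 < t → t ≤ ρ → r k ≤ θ → θ ≤ r (k + 1) →
      ‖F k (polar t θ)‖ ≤ M := by
    intro k
    by_cases hk : k < n
    · obtain ⟨δ, M, hδ, hM⟩ := h.bounded k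
      obtain ⟨M', hM'⟩ := exists_norm_le_of_sector (h.differentiableOn k).continuousOn hδ hM
        (hA k hk) (hB k hk) hρε
      exact ⟨M', fun _ => hM'⟩
    · exact ⟨0, fun hk' => absurd hk' hk⟩
  choose M hM using hbd
  choose D hD using h.jump
  have hsum : ∀ (u : ℕ → ℝ), ∀ k < n, u k ≤ ∑ j ∈ Finset.range n, |u j| := fun u k hk =>
    (le_abs_self _).trans (Finset.single_le_sum (f := fun j => |u j|)
      (fun j _ => abs_nonneg _) (Finset.mem_range.2 hk))
  refine ⟨r, ∑ k ∈ Finset.range n, |M k|, ∑ k ∈ Finset.range n, |D k|, ?_, ?_, hr0, hr1⟩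
  · refine ⟨h.pos, hρ, hmono, hrn, by simpa using h.periodic 0, ?_, ?_⟩
    · intro k hk t θ h1 h2 h3 h4
      exact (h.differentiableOn k).analyticAt ((isOpen_sector _ _ _).mem_nhds
        (polar_mem_sector h1 (h2.trans_lt hρε) ((hA k hk).trans_le h3) (h4.trans_lt (hB k hk))))
    · intro k hk t θ h1 h2 h3 h4
      exact (hM k hk t θ h1 h2 h3 h4).trans (hsum M k hk)
  · intro k hk t h1 h2
    exact (hD k t _ h1 (h2.trans_lt hρε) (hA' k hk) (hB k hk)).trans
      (mul_le_mul_of_nonneg_right (hsum D k hk) (Real.exp_pos _).le)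

lemma exists_hasExpansionOn [CompleteSpace E] (h : IsLiftedCovering n A B ε₀ Λ F) (hΛ : 0 < Λ)
    (k : ℕ) {a₁ b₁ ρ₁ : ℝ} (ha : A k < a₁) (hab : a₁ < b₁) (hb : b₁ < B k) (hρ₁ : 0 < ρ₁)
    (hρ₁ε : ρ₁ < ε₀) : ∃ g : ℕ → E, HasExpansionOn Λ (F k) g (sector a₁ b₁ ρ₁) := by
  obtain ⟨ρ, hρ, hρε⟩ := exists_between hρ₁ε
  obtain ⟨r, M, D, hF, hJ, hr0, hr1⟩ := (h.shift k).exists_chain ha hab hb (hρ₁.trans hρ) hρε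
  exact ⟨_, hF.exists_expansion hJ hΛ hr0 hr1 hρ⟩

/-- The rays, hence the coefficients, depend on the subsector. Enlarging each subsector to contain a
fixed reference one allows uniqueness to identify the coefficients. -/
lemma exists_hasExpansionOn_sector [CompleteSpace E] (h : IsLiftedCovering n A B ε₀ Λ F)
    (hΛ : 0 < Λ) (k : ℕ) :
    ∃ g : ℕ → E, ∀ a₁ b₁ ρ₁ : ℝ, A k < a₁ → a₁ < b₁ → b₁ < B k → 0 < ρ₁ → ρ₁ < ε₀ →
      HasExpansionOn Λ (F k) g (sector a₁ b₁ ρ₁) := by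
  have hε := h.radius_pos
  have hAB : A k < B k := (h.mono_left (Nat.le_succ k)).trans_lt (h.overlap k)
  obtain ⟨θ, hAθ, hθB⟩ := exists_between hAB
  obtain ⟨a₀, hAa, haθ⟩ := exists_between hAθ
  obtain ⟨b₀, hθb, hbB⟩ := exists_between hθB
  obtain ⟨g, hg⟩ := h.exists_hasExpansionOn hΛ k hAa (haθ.trans hθb) hbB (half_pos hε)
    (half_lt_self hε)
  refine ⟨g, fun a₁ b₁ ρ₁ h1 h2 h3 h4 h5 => ?_⟩
  have hρ' : 0 < max ρ₁ (ε₀ / 2) := lt_max_of_lt_left h4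
  obtain ⟨g', hg'⟩ := h.exists_hasExpansionOn hΛ k (a₁ := min a₁ a₀) (b₁ := max b₁ b₀)
    (lt_min h1 hAa) ((min_le_left _ _).trans_lt (h2.trans_le (le_max_left _ _))) (max_lt h3 hbB)
    hρ' (max_lt h5 (half_lt_self hε))
  have : g = g' := hg.unique hg' (half_pos hε) hρ' haθ hθb ((min_le_right _ _).trans_lt haθ)
    (hθb.trans_le (le_max_right _ _)) fun N => ⟨0, by simp⟩
  rw [this]
  exact hg'.mono (sector_subset_sector (min_le_left _ _) (le_max_left _ _) (le_max_left _ _))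

/-- The members of a covering with flat differences share one asymptotic expansion. -/
theorem exists_common_expansion [CompleteSpace E] (h : IsLiftedCovering n A B ε₀ Λ F)
    (hΛ : 0 < Λ) :
    ∃ g : ℕ → E, ∀ k, ∀ a₁ b₁ ρ₁ : ℝ, A k < a₁ → a₁ < b₁ → b₁ < B k → 0 < ρ₁ → ρ₁ < ε₀ →
      HasExpansionOn Λ (F k) g (sector a₁ b₁ ρ₁) := by
  choose g hg using h.exists_hasExpansionOn_sector hΛ
  have hε := h.radius_pos
  have hstep : ∀ k, g k = g (k + 1) := by
    intro k
    obtain ⟨θ, hAθ, hθB⟩ := exists_between (h.overlap k)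
    obtain ⟨a₀, hAa, haθ⟩ := exists_between hAθ
    obtain ⟨b₀, hθb, hbB⟩ := exists_between hθB
    have h1 := hg k a₀ b₀ (ε₀ / 2) ((h.mono_left (Nat.le_succ k)).trans_lt hAa) (haθ.trans hθb) hbB
      (half_pos hε) (half_lt_self hε)
    have h2 := hg (k + 1) a₀ b₀ (ε₀ / 2) hAa (haθ.trans hθb)
      (hbB.trans_le (h.mono_right (Nat.le_succ k))) (half_pos hε) (half_lt_self hε)
    -- The jump decays faster than every power of `t`, so it does not affect the coefficients.
    refine h1.unique h2 (half_pos hε) (half_pos hε) haθ hθb haθ hθb fun N => ?_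
    obtain ⟨D, hD⟩ := h.jump k
    refine ⟨|D| * Real.exp (Λ * ((N + 1 : ℕ) : ℝ) ^ 2 / 2), ?_⟩
    filter_upwards [Ioo_mem_nhdsGT hε] with t ht
    have hp : 0 < t ^ (N + 1) := pow_pos ht.1 _
    have h3 := inv_pow_mul_exp_neg_log_sq_le hΛ ht.1 (N + 1)
    rw [inv_mul_le_iff₀ hp] at h3
    refine (hD t θ ht.1 ht.2 hAθ hθB).trans ?_
    calc _ ≤ |D| * Real.exp (-(Real.log t ^ 2 / (2 * Λ))) :=
          mul_le_mul_of_nonneg_right (le_abs_self D) (Real.exp_pos _).le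
      _ ≤ |D| * (t ^ (N + 1) * Real.exp (Λ * ((N + 1 : ℕ) : ℝ) ^ 2 / 2)) :=
          mul_le_mul_of_nonneg_left h3 (abs_nonneg D)
      _ = _ := by ring
  have hall : ∀ k, g k = g 0 := fun k => by
    induction k with
    | zero => rfl
    | succ k ih => rw [← hstep k, ih]
  exact ⟨g 0, fun k => hall k ▸ hg k⟩

end IsLiftedCovering

/-! ### Unrolling a cyclic covering along `ℕ` -/

section Lift

variable {ν : ℕ} [NeZero ν]

/-- The extension of a family of angles to `ℕ` that grows by `2π` in every turn. -/
noncomputable def liftAngle (c : Fin ν → ℝ) (k : ℕ) : ℝ :=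
  c (Fin.ofNat ν k) + (k / ν : ℕ) * (2 * Real.pi)

lemma ofNat_succ (k : ℕ) : Fin.ofNat ν (k + 1) = Fin.ofNat ν k + 1 := by
  ext
  simp [Fin.val_add]

lemma ofNat_add_self (k : ℕ) : Fin.ofNat ν (k + ν) = Fin.ofNat ν k := by
  ext
  simp

lemma liftAngle_val (c : Fin ν → ℝ) (i : Fin ν) : liftAngle c i = c i := by
  have h : Fin.ofNat ν (i : ℕ) = i := by
    ext
    simp
  rw [liftAngle, h, Nat.div_eq_of_lt i.isLt]
  simp

lemma liftAngle_add (c : Fin ν → ℝ) (k : ℕ) :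
    liftAngle c (k + ν) = liftAngle c k + 2 * Real.pi := by
  unfold liftAngle
  rw [ofNat_add_self, Nat.add_div_right _ (NeZero.pos ν)]
  push_cast
  ring

/-- The value of a lifted family at the successor of an index. -/
lemma liftAngle_succ (c : Fin ν → ℝ) (k : ℕ) :
    (∃ j : Fin ν, (j : ℕ) = (Fin.ofNat ν k : ℕ) + 1 ∧
      liftAngle c (k + 1) = c j + (k / ν : ℕ) * (2 * Real.pi)) ∨
    ((Fin.ofNat ν k : ℕ) + 1 = ν ∧
      liftAngle c (k + 1) = c 0 + 2 * Real.pi + (k / ν : ℕ) * (2 * Real.pi)) := by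
  have hν : 0 < ν := NeZero.pos ν
  have hval : (Fin.ofNat ν k : ℕ) = k % ν := rfl
  have hk := Nat.div_add_mod k ν
  have hlt := Nat.mod_lt k hν
  rw [hval]
  rcases Nat.lt_or_ge (k % ν + 1) ν with h | h
  · left
    refine ⟨⟨k % ν + 1, h⟩, rfl, ?_⟩
    have e : k + 1 = (k % ν + 1) + ν * (k / ν) := by omega
    have h1 : (k + 1) % ν = k % ν + 1 := by
      conv_lhs => rw [e]
      rw [Nat.add_mul_mod_self_left, Nat.mod_eq_of_lt h]
    have h2 : (k + 1) / ν = k / ν := by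
      conv_lhs => rw [e]
      rw [Nat.add_mul_div_left _ _ hν, Nat.div_eq_of_lt h, zero_add]
    have h3 : Fin.ofNat ν (k + 1) = ⟨k % ν + 1, h⟩ := Fin.ext h1
    rw [liftAngle, h3, h2]
  · right
    refine ⟨by omega, ?_⟩
    have e : k + 1 = 0 + ν * (k / ν + 1) := by
      rw [mul_add]
      omega
    have h1 : (k + 1) % ν = 0 := by
      rw [e, Nat.add_mul_mod_self_left, Nat.zero_mod]
    have h2 : (k + 1) / ν = k / ν + 1 := by
      conv_lhs => rw [e]
      rw [Nat.add_mul_div_left _ _ hν, Nat.zero_div, zero_add]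
    have h3 : Fin.ofNat ν (k + 1) = 0 := Fin.ext (by simpa using h1)
    rw [liftAngle, h3, h2]
    push_cast
    ring

/-- Within a turn this is monotonicity of `c`; at the passage to the next turn it is the `2π` bound.
-/
lemma monotone_liftAngle {c : Fin ν → ℝ} (hc : Monotone c) (hc' : ∀ i j, c i ≤ c j + 2 * Real.pi) :
    Monotone (liftAngle c) := by
  refine monotone_nat_of_le_succ fun k => ?_
  rcases liftAngle_succ c k with ⟨j, hj, h⟩ | ⟨-, h⟩
  · rw [h, liftAngle]
    have : c (Fin.ofNat ν k) ≤ c j := hc (Fin.le_def.2 (by omega))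
    linarith
  · rw [h, liftAngle]
    linarith [hc' (Fin.ofNat ν k) 0]

lemma sector_add_nat_mul_two_pi (a b ρ : ℝ) (d : ℕ) :
    sector (a + d * (2 * Real.pi)) (b + d * (2 * Real.pi)) ρ = sector a b ρ := by
  have hpolar : ∀ t θ : ℝ, polar t (θ + d * (2 * Real.pi)) = polar t θ := fun t θ => by
    have hp : Function.Periodic (polar t) (2 * Real.pi) := polar_add_two_pi t
    exact hp.nat_mul d θ
  ext z
  constructor
  · rintro ⟨t, θ, h1, h2, h3, h4, rfl⟩
    refine ⟨t, θ - d * (2 * Real.pi), h1, h2, by linarith, by linarith, ?_⟩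
    have := hpolar t (θ - d * (2 * Real.pi))
    rwa [sub_add_cancel] at this
  · rintro ⟨t, θ, h1, h2, h3, h4, rfl⟩
    exact ⟨t, θ + d * (2 * Real.pi), h1, h2, by linarith, by linarith, (hpolar t θ).symm⟩

lemma sector_liftAngle (a b : Fin ν → ℝ) (ρ : ℝ) (k : ℕ) :
    sector (liftAngle a k) (liftAngle b k) ρ =
      sector (a (Fin.ofNat ν k)) (b (Fin.ofNat ν k)) ρ :=
  sector_add_nat_mul_two_pi _ _ _ _

lemma exists_int_of_polar_eq {t s θ φ : ℝ} (ht : 0 < t) (hs : 0 < s)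
    (h : polar t θ = polar s φ) : ∃ m : ℤ, θ = φ + m * (2 * Real.pi) := by
  have hts : t = s := by
    have := congrArg norm h
    rwa [norm_polar ht.le, norm_polar hs.le] at this
  subst hts
  have h1 : Complex.exp ((θ : ℂ) * Complex.I) = Complex.exp ((φ : ℂ) * Complex.I) :=
    mul_left_cancel₀ (Complex.ofReal_ne_zero.2 ht.ne') h
  obtain ⟨m, hm⟩ := Complex.exp_eq_exp_iff_exists_int.1 h1
  refine ⟨m, ?_⟩
  have := congrArg Complex.im hm
  simpa using this

/-- Consecutive sectors of a covering of a punctured disc overlap beyond the larger left end. -/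
lemma liftAngle_succ_lt {a b : Fin ν → ℝ} {ε₀ r₀ : ℝ} (hr₀ : 0 < r₀)
    (hcov : Metric.ball (0 : ℂ) r₀ \ {0} ⊆ ⋃ i, sector (a i) (b i) ε₀) (ho : InCyclicOrder a b)
    (k : ℕ) : liftAngle a (k + 1) < liftAngle b k := by
  obtain ⟨ha, hb, ha', hb'⟩ := ho
  set i := Fin.ofNat ν k with hi
  -- Otherwise no sector contains the direction `b i`. If sector `j` did, at an angle differing by
  -- `m` turns, then `m < 0` would exceed `b j`, `m > 0` would fall below `a j`, and `m = 0` would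
  -- force `j` after `i`, so that `a j` is already at least `b i`.
  by_contra! hcon
  have hmem : polar (r₀ / 2) (b i) ∈ Metric.ball (0 : ℂ) r₀ \ {0} := by
    refine ⟨?_, polar_ne_zero (half_pos hr₀) _⟩
    rw [mem_ball_zero_iff, norm_polar (half_pos hr₀).le]
    exact half_lt_self hr₀
  obtain ⟨j, s, φ, hs, -, hjφ, hφj, heq⟩ := mem_iUnion.1 (hcov hmem)
  obtain ⟨m, hm⟩ := exists_int_of_polar_eq (half_pos hr₀) hs heq
  have hpi := Real.pi_pos
  have hnext : ∀ j, liftAngle a (k + 1) ≤ a j + 2 * Real.pi + (k / ν : ℕ) * (2 * Real.pi) := by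
    intro j
    rcases liftAngle_succ a k with ⟨l, -, h⟩ | ⟨-, h⟩
    · rw [h]
      linarith [ha' l j]
    · rw [h]
      linarith [ha (Fin.zero_le j)]
  rw [liftAngle, ← hi] at hcon
  rcases lt_trichotomy m 0 with h0 | h0 | h0
  · have : (m : ℝ) ≤ -1 := by exact_mod_cast (show m ≤ -1 by omega)
    nlinarith [hb' j i]
  · rw [h0, Int.cast_zero, zero_mul, add_zero] at hm
    have hij : i < j := by
      by_contra h
      linarith [hb (not_lt.1 h)]
    rcases liftAngle_succ a k with ⟨l, hl, h⟩ | ⟨hl, h⟩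
    · rw [h] at hcon
      have : l ≤ j := Fin.le_def.2 (by rw [hl, ← hi]; exact hij)
      linarith [ha this]
    · have := j.isLt
      rw [Fin.lt_def, hi] at hij
      omega
  · have : (1 : ℝ) ≤ m := by exact_mod_cast (show 1 ≤ m by omega)
    nlinarith [hnext j]

lemma isLiftedCovering_liftAngle {q L : ℝ} (hq0 : 0 < q) (hq1 : q < 1) (hL : 0 < L)
    {a b : Fin ν → ℝ} {ε₀ r₀ : ℝ} (hr₀ : 0 < r₀) (hwidth : ∀ i, b i ≤ a i + 2 * Real.pi)
    (hcov : Metric.ball (0 : ℂ) r₀ \ {0} ⊆ ⋃ i, sector (a i) (b i) ε₀) (ho : InCyclicOrder a b)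
    {G : Fin ν → ℂ → E} (hhol : ∀ i, DifferentiableOn ℂ (G i) (sector (a i) (b i) ε₀))
    (hbdd : ∀ i, ∃ δ M : ℝ, 0 < δ ∧ ∀ ε ∈ sector (a i) (b i) ε₀, ‖ε‖ < δ → ‖G i ε‖ ≤ M)
    (hΔ : ∀ i, HasQExpDecrease q L
      (sector (a i) (b i) ε₀ ∩ sector (a (i + 1)) (b (i + 1)) ε₀)
      (fun ε => G (i + 1) ε - G i ε)) :
    IsLiftedCovering ν (liftAngle a) (liftAngle b) ε₀ (L * -Real.log q)
      (fun k => G (Fin.ofNat ν k)) where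
  pos := NeZero.pos ν
  radius_pos := by
    have hmem : polar (r₀ / 2) 0 ∈ Metric.ball (0 : ℂ) r₀ \ {0} := by
      refine ⟨?_, polar_ne_zero (half_pos hr₀) _⟩
      rw [mem_ball_zero_iff, norm_polar (half_pos hr₀).le]
      exact half_lt_self hr₀
    obtain ⟨j, s, φ, hs, hs', -⟩ := mem_iUnion.1 (hcov hmem)
    exact hs.trans hs'
  mono_left := monotone_liftAngle ho.1 ho.2.2.1
  mono_right := monotone_liftAngle ho.2.1 ho.2.2.2
  turn_left := liftAngle_add a
  turn_right := liftAngle_add b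
  periodic k := by rw [ofNat_add_self]
  width k := by
    unfold liftAngle
    linarith [hwidth (Fin.ofNat ν k)]
  overlap := liftAngle_succ_lt hr₀ hcov ho
  differentiableOn k := by
    rw [sector_liftAngle]
    exact hhol _
  bounded k := by
    rw [sector_liftAngle]
    exact hbdd _
  jump k := by
    obtain ⟨C, hC, h⟩ := hΔ (Fin.ofNat ν k)
    refine ⟨C, fun t θ h1 h2 h3 h4 => ?_⟩
    -- By monotonicity, an angle between `A (k + 1)` and `B k` lies in both sectors.
    have hA := monotone_liftAngle ho.1 ho.2.2.1 (Nat.le_succ k)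
    have hB := monotone_liftAngle ho.2.1 ho.2.2.2 (Nat.le_succ k)
    have hmem₁ := polar_mem_sector h1 h2 (hA.trans_lt h3) h4
    have hmem₂ := polar_mem_sector h1 h2 h3 (h4.trans_le hB)
    rw [sector_liftAngle] at hmem₁ hmem₂
    rw [ofNat_succ] at hmem₂ ⊢
    refine (h _ ⟨hmem₁, hmem₂⟩).trans_eq ?_
    have hlog : Real.log q < 0 := Real.log_neg hq0 hq1
    rw [norm_polar h1.le]
    congr 2
    have : -Real.log q ≠ 0 := by linarith
    field_simp

end Lift

/-! ### Absorbing factorials, and the two orientations -/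

lemma rpow_neg_half_eq_exp {q : ℝ} (hq : 0 < q) (A : ℝ) (N : ℕ) :
    q ^ (-(A * (N : ℝ) ^ 2 / 2)) = Real.exp (A * -Real.log q * (N : ℝ) ^ 2 / 2) := by
  rw [Real.rpow_def_of_pos hq]
  congr 1
  ring

lemma factorial_succ_le_pow (N : ℕ) : (N + 1).factorial ≤ (N + 1) ^ N := by
  induction N with
  | zero => simp
  | succ N ih =>
    rw [Nat.factorial_succ, pow_succ' (N + 1 + 1)]
    exact Nat.mul_le_mul_left _ (ih.trans (Nat.pow_le_pow_left (Nat.le_succ _) N))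

/-- `(N + 1)! ≤ (N + 1) ^ N`, and `N + 1` is at most a constant times `exp (μN/2)`; the `N`-th power
turns this into a Gaussian factor. -/
lemma exists_factorial_le_pow_mul_exp {μ : ℝ} (hμ : 0 < μ) :
    ∃ K : ℝ, 0 < K ∧ ∀ N : ℕ,
      ((N + 1).factorial : ℝ) ≤ K ^ N * Real.exp (μ * (N : ℝ) ^ 2 / 2) := by
  refine ⟨1 + 2 / μ, by positivity, fun N => ?_⟩
  have h1 : (N : ℝ) + 1 ≤ (1 + 2 / μ) * Real.exp (μ * N / 2) := by
    have h2 := Real.add_one_le_exp (μ * N / 2)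
    have h3 : (1 + 2 / μ) * (μ * N / 2 + 1) = N + 1 + (μ * N / 2 + 2 / μ) := by
      field_simp
      ring
    have h4 : 0 ≤ μ * N / 2 + 2 / μ := by positivity
    exact (by linarith : (N : ℝ) + 1 ≤ (1 + 2 / μ) * (μ * N / 2 + 1)).trans
      (mul_le_mul_of_nonneg_left h2 (by positivity))
  calc ((N + 1).factorial : ℝ) ≤ ((N : ℝ) + 1) ^ N := by exact_mod_cast factorial_succ_le_pow N
    _ ≤ ((1 + 2 / μ) * Real.exp (μ * N / 2)) ^ N := pow_le_pow_left₀ (by positivity) h1 N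
    _ = _ := by
      rw [mul_pow, ← Real.exp_nat_mul]
      congr 2
      ring

lemma HasWeightedExpansion.of_hasExpansionOn {q L a b ρ : ℝ} (hq : 0 < q) {f : ℂ → E} {g : ℕ → E}
    (h : ∀ a₁ b₁ ρ₁ : ℝ, a < a₁ → a₁ < b₁ → b₁ < b → 0 < ρ₁ → ρ₁ < ρ →
      HasExpansionOn (L * -Real.log q) f g (sector a₁ b₁ ρ₁)) :
    HasWeightedExpansion q L (fun _ => 1) a b ρ f g := by
  intro a₁ b₁ ρ₁ h1 h2 h3 h4 h5
  obtain ⟨C, H, hC, hH, hb⟩ := h a₁ b₁ ρ₁ h1 h2 h3 h4 h5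
  refine ⟨C, H, hC, hH, fun N ε hε => ?_⟩
  rw [rpow_neg_half_eq_exp hq, mul_one]
  exact hb N ε hε

/-- A larger type absorbs the factorials. -/
lemma HasWeightedExpansion.hasQGevreyExpansion {q L L' a b ρ : ℝ} (hq0 : 0 < q) (hq1 : q < 1)
    (hLL' : L < L') {f : ℂ → E} {g : ℕ → E}
    (h : HasWeightedExpansion q L (fun _ => 1) a b ρ f g) :
    HasQGevreyExpansion q L' a b ρ f g := by
  intro a₁ b₁ ρ₁ h1 h2 h3 h4 h5
  obtain ⟨C, H, hC, hH, hb⟩ := h a₁ b₁ ρ₁ h1 h2 h3 h4 h5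
  have hlog : Real.log q < 0 := Real.log_neg hq0 hq1
  obtain ⟨K, hK, hfac⟩ := exists_factorial_le_pow_mul_exp
    (show 0 < (L' - L) * -Real.log q from mul_pos (by linarith) (by linarith))
  refine ⟨C, H * K, hC, mul_pos hH hK, fun N ε hε => (hb N ε hε).trans ?_⟩
  refine mul_le_mul_of_nonneg_right ?_ (by positivity)
  have hN : (0 : ℝ) < ((N + 1).factorial : ℝ) := by exact_mod_cast Nat.factorial_pos _
  rw [mul_one, rpow_neg_half_eq_exp hq0, rpow_neg_half_eq_exp hq0, mul_one_div, le_div_iff₀ hN]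
  have hexp : Real.exp (L' * -Real.log q * (N : ℝ) ^ 2 / 2) =
      Real.exp (L * -Real.log q * (N : ℝ) ^ 2 / 2) *
        Real.exp ((L' - L) * -Real.log q * (N : ℝ) ^ 2 / 2) := by
    rw [← Real.exp_add]
    congr 1
    ring
  rw [hexp, mul_pow]
  calc _ ≤ C * H ^ N * Real.exp (L * -Real.log q * (N : ℝ) ^ 2 / 2) *
        (K ^ N * Real.exp ((L' - L) * -Real.log q * (N : ℝ) ^ 2 / 2)) :=
        mul_le_mul_of_nonneg_left (hfac N) (by positivity)
    _ = _ := by ring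

/-- The theorem for sectors that are numbered counterclockwise. -/
theorem exists_weightedExpansion_of_inCyclicOrder [CompleteSpace E] {q L : ℝ} (hq0 : 0 < q)
    (hq1 : q < 1) (hL : 0 < L) {ν : ℕ} [NeZero ν] {a b : Fin ν → ℝ} {ε₀ r₀ : ℝ} (hr₀ : 0 < r₀)
    (hwidth : ∀ i, b i ≤ a i + 2 * Real.pi)
    (hcov : Metric.ball (0 : ℂ) r₀ \ {0} ⊆ ⋃ i, sector (a i) (b i) ε₀) (ho : InCyclicOrder a b)
    {G : Fin ν → ℂ → E} (hhol : ∀ i, DifferentiableOn ℂ (G i) (sector (a i) (b i) ε₀))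
    (hbdd : ∀ i, ∃ δ M : ℝ, 0 < δ ∧ ∀ ε ∈ sector (a i) (b i) ε₀, ‖ε‖ < δ → ‖G i ε‖ ≤ M)
    (hΔ : ∀ i, HasQExpDecrease q L
      (sector (a i) (b i) ε₀ ∩ sector (a (i + 1)) (b (i + 1)) ε₀)
      (fun ε => G (i + 1) ε - G i ε)) :
    ∃ g : ℕ → E, ∀ i, HasWeightedExpansion q L (fun _ => 1) (a i) (b i) ε₀ (G i) g := by
  have hΛ : 0 < L * -Real.log q := mul_pos hL (neg_pos.2 (Real.log_neg hq0 hq1))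
  obtain ⟨g, hg⟩ := (isLiftedCovering_liftAngle hq0 hq1 hL hr₀ hwidth hcov ho hhol hbdd
    hΔ).exists_common_expansion hΛ
  refine ⟨g, fun i => HasWeightedExpansion.of_hasExpansionOn hq0 ?_⟩
  have h := hg i
  have hi : Fin.ofNat ν (i : ℕ) = i := by
    ext
    simp
  rwa [liftAngle_val, liftAngle_val, hi] at h

lemma rev_add_one_add_one {ν : ℕ} [NeZero ν] (i : Fin ν) : (i + 1).rev + 1 = i.rev := by
  obtain ⟨n, rfl⟩ : ∃ n, ν = n + 1 := ⟨ν - 1, by have := NeZero.pos ν; omega⟩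
  rw [← Fin.last_sub, ← Fin.last_sub, sub_add_eq_sub_sub, sub_add_cancel]

end QGevrey

end

theorem mainTheorem2 {E : Type*} [NormedAddCommGroup E] [NormedSpace ℂ E] [CompleteSpace E]
    (q : ℝ) (hq0 : 0 < q) (hq1 : q < 1) {ν : ℕ} [NeZero ν] (a b : Fin ν → ℝ) (ε₀ : ℝ)
    (hcov : QGevrey.IsGoodCovering a b ε₀) (G : Fin ν → ℂ → E)
    (hhol : ∀ i, DifferentiableOn ℂ (G i) (QGevrey.sector (a i) (b i) ε₀))
    (hbdd : ∀ i, ∃ δ M : ℝ, 0 < δ ∧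
      ∀ ε ∈ QGevrey.sector (a i) (b i) ε₀, ‖ε‖ < δ → ‖G i ε‖ ≤ M)
    (L : ℝ) (hL : 0 < L)
    (hΔ : ∀ i, QGevrey.HasQExpDecrease q L
      (QGevrey.sector (a i) (b i) ε₀ ∩ QGevrey.sector (a (i + 1)) (b (i + 1)) ε₀)
      (fun ε => G (i + 1) ε - G i ε)) :
    ∃ g : ℕ → E, ∀ i,
      (∀ L' : ℝ, L < L' → QGevrey.HasQGevreyExpansion q L' (a i) (b i) ε₀ (G i) g) ∧
        QGevrey.HasWeightedExpansion q L (fun _ => 1) (a i) (b i) ε₀ (G i) g := by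
  obtain ⟨hwidth, -, ⟨r₀, hr₀, hball⟩, ho⟩ := hcov
  suffices h : ∃ g : ℕ → E, ∀ i,
      QGevrey.HasWeightedExpansion q L (fun _ => 1) (a i) (b i) ε₀ (G i) g by
    obtain ⟨g, hg⟩ := h
    exact ⟨g, fun i => ⟨fun L' hL' => (hg i).hasQGevreyExpansion hq0 hq1 hL', hg i⟩⟩
  rcases ho with ho | ho
  · exact QGevrey.exists_weightedExpansion_of_inCyclicOrder hq0 hq1 hL hr₀
      (fun i => (hwidth i).2) hball ho hhol hbdd hΔ
  · have hball' : Metric.ball (0 : ℂ) r₀ \ {0} ⊆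
        ⋃ i, QGevrey.sector ((a ∘ Fin.rev) i) ((b ∘ Fin.rev) i) ε₀ := fun z hz => by
      obtain ⟨i, hi⟩ := Set.mem_iUnion.1 (hball hz)
      refine Set.mem_iUnion.2 ⟨i.rev, ?_⟩
      simpa only [Function.comp, Fin.rev_rev] using hi
    obtain ⟨g, hg⟩ := QGevrey.exists_weightedExpansion_of_inCyclicOrder hq0 hq1 hL hr₀
      (G := G ∘ Fin.rev) (fun i => (hwidth i.rev).2) hball' ho (fun i => hhol i.rev)
      (fun i => hbdd i.rev) (fun i => by
        -- Reversal makes successors predecessors: the pair `i, i + 1` becomes the pair starting at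
        -- `(i + 1).rev`, with its members exchanged.
        obtain ⟨C, hC, h⟩ := hΔ (i + 1).rev
        rw [QGevrey.rev_add_one_add_one] at h
        exact ⟨C, hC, fun ε hε => by
          rw [Function.comp, Function.comp, norm_sub_rev]
          exact h ε hε.symm⟩)
    refine ⟨g, fun i => ?_⟩
    have := hg i.rev
    simpa only [Function.comp, Fin.rev_rev] using this
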